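/- Let $\Omega=\{x\in\mathbb R^2:|x|<1\}$, with outward unit normal $n(x)=x$ on $\partial\Omega$, let $R_x=I-2\,n(x)\otimes n(x)$ and let $Q$ be the counterclockwise rotation by $\pi/2$. Put $\gamma_\pm=\{(x,v)\in\partial\Omega\times\mathbb R^2:\pm v\cdot n(x)>0\}$, $\gamma_0=\{(x,v)\in\partial\Omega\times\mathbb R^2: v\cdot n(x)=0\}$, $\mathcal I=(\overline\Omega\times\mathbb R^2)\setminus\gamma_0$ and $\mathbb R_+=[0,\infty)$. For $(x,v)\in\mathcal I$ let $t_{\mathbf b}(x,v)=\sup\{s\ge 0: x-sv\in\Omega\}\in[0,\infty]$ (with $\sup\emptyset=0$). For $(t,x,v)\in\mathbb R_+\times\mathcal I$ define $(t^0,x^0,v^0)=(t,x,v)$ and, for $k\ge1$, $$t^k=t^{k-1}-t_{\mathbf b}(x^{k-1},v^{k-1}),\qquad x^k=x^{k-1}-t_{\mathbf b}(x^{k-1},v^{k-1})v^{k-1},\qquad v^k=R_{x^k}v^{k-1}$$ (for $v=0$, $x\in\Omega$ one has $t^k=-\infty$, $x^k=x$, $v^k=0$ for $k\ge1$), and the specular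 characteristics $$X(s;t,x,v)=\sum_{k}\mathbf 1_{s\in(t^{k+1},t^k]}\big(x^k-(t^k-s)v^k\big),\qquad V(s;t,x,v)=\sum_k\mathbf 1_{s\in(t^{k+1},t^k]}v^k .$$ Let $f_0\in C^1_{x,v}(\overline\Omega\times\mathbb R^2)$ be real-valued with $f_0(x,v)=f_0(x,R_xv)$ for all $x\in\partial\Omega$, $v\in\mathbb R^2$, and put $f(t,x,v)=f_0(X(0;t,x,v),V(0;t,x,v))$ for $(t,x,v)\in\mathbb R_+\times\mathcal I$. Gradients are row vectors, $a\otimes b=ab^T$, and $C^1$ is understood up to the boundary. Consider, for $(x,v)\in\gamma_-\cup\gamma_+$, the condition $$\Big[\nabla_xf_0(x,v)+\nabla_vf_0(x,v)\frac{(Qv)\otimes(Qv)}{v\cdot n(x)}\Big]R_x=\nabla_xf_0(x,R_xv)+\nabla_vf_0(x,R_xv)\frac{(QR_xv)\otimes(QR_xv)}{R_xv\cdot n(x)}.\tag{C}$$ 1. If (C) holds for all $(x,v)\in\gamma_-$, then $f$ is the unique function in $C^1_{t,x,v}(\mathbb R_+\times\mathcal I)$ that satisfies $\partial_tf+v\cdot\nabla_xf=0$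 for $t>0$, $x\in\Omega$, $v\in\mathbb R^2$, the boundary condition $f(t,x,v)=f(t,x,R_xv)$ for $t\ge0$, $(x,v)\in\gamma_-\cup\gamma_+$, and the initial condition $f(0,\cdot,\cdot)=f_0$ on $\mathcal I$. Moreover (C) then also holds for all $(x,v)\in\gamma_+$. 2. Let $(t,x,v)\in\mathbb R_+\times\mathcal I$ and $k\ge1$ be such that $t^k(t,x,v)=0$. If (C) fails at the corresponding point $(x^k,v^{k-1})\in\gamma_-$, then $f$ is not of class $C^1_{t,x,v}$ at $(t,x,v)$, i.e. not $C^1$ on any relative neighbourhood of $(t,x,v)$ in $\mathbb R_+\times\mathcal I$. -/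

import Mathlib

open Set
open scoped NNReal ENNReal Matrix

noncomputable section

namespace DiskTransport

/-- The Euclidean plane. -/
abbrev Plane : Type := EuclideanSpace ℝ (Fin 2)

/-- The open unit disk `Ω`. -/
def disk : Set Plane := {x | ‖x‖ < 1}

/-- The closed unit disk, i.e. the closure of `Ω`. -/
def closedDisk : Set Plane := {x | ‖x‖ ≤ 1}

/-- The unit circle `∂Ω`. The outward unit normal at `x ∈ ∂Ω` is `n(x) = x`. -/
def circ : Set Plane := {x | ‖x‖ = 1}

/-- Incoming boundary set: `v · n(x) < 0`. -/
def gammaMinus : Set (Plane × Plane) := {p | p.1 ∈ circ ∧ inner ℝ p.2 p.1 < 0}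

/-- Grazing boundary set: `v · n(x) = 0`. -/
def gammaZero : Set (Plane × Plane) := {p | p.1 ∈ circ ∧ inner ℝ p.2 p.1 = 0}

/-- Outgoing boundary set: `v · n(x) > 0`. -/
def gammaPlus : Set (Plane × Plane) := {p | p.1 ∈ circ ∧ 0 < inner ℝ p.2 p.1}

/-- The closed phase space: (closed disk) `× ℝ²`. -/
def phase : Set (Plane × Plane) := closedDisk ×ˢ univ

/-- `𝓘`: the closed phase space without the grazing set. -/
def nonGrazing : Set (Plane × Plane) := phase \ gammaZero

/-- `ℝ₊ × 𝓘`, with `ℝ₊ = [0, ∞)`. -/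
def timePhase : Set (ℝ × Plane × Plane) := Ici 0 ×ˢ nonGrazing

/-- The matrix `R_x = I - 2 n(x) ⊗ n(x)`, with `n(x) = x`. -/
def reflMat (x : Plane) : Matrix (Fin 2) (Fin 2) ℝ :=
  1 - (2 : ℝ) • Matrix.vecMulVec x.ofLp x.ofLp

/-- The vector `R_x v`. -/
def specRefl (x v : Plane) : Plane := WithLp.toLp 2 (reflMat x *ᵥ v.ofLp)

/-- Counterclockwise rotation by `π / 2`. -/
def rotQ : Matrix (Fin 2) (Fin 2) ℝ := !![0, -1; 1, 0]

/-- The matrix `(Qv) ⊗ (Qv) / (v · n(x))`, with `n(x) = x`. -/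
def dyad (x v : Plane) : Matrix (Fin 2) (Fin 2) ℝ :=
  (1 / inner ℝ v x : ℝ) • Matrix.vecMulVec (rotQ *ᵥ v.ofLp) (rotQ *ᵥ v.ofLp)

/-- The row vector `∇ₓ f₀(x, v)`; at boundary points the derivative is taken within the closed
phase space. -/
def gradX (f₀ : Plane × Plane → ℝ) (x v : Plane) : Fin 2 → ℝ :=
  fun i => fderivWithin ℝ f₀ phase (x, v) (EuclideanSpace.single i 1, 0)

/-- The row vector `∇ᵥ f₀(x, v)`. -/
def gradV (f₀ : Plane × Plane → ℝ) (x v : Plane) : Fin 2 → ℝ :=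
  fun i => fderivWithin ℝ f₀ phase (x, v) (0, EuclideanSpace.single i 1)

/-- The first order compatibility condition at a point `(x, v)`:
`[∇ₓf₀(x,v) + ∇ᵥf₀(x,v) (Qv)⊗(Qv)/(v·n)] R_x
  = ∇ₓf₀(x,R_x v) + ∇ᵥf₀(x,R_x v) (QR_x v)⊗(QR_x v)/(R_x v·n)`. -/
def CompatAt (f₀ : Plane × Plane → ℝ) (x v : Plane) : Prop :=
  (gradX f₀ x v + gradV f₀ x v ᵥ* dyad x v) ᵥ* reflMat x =
    gradX f₀ x (specRefl x v) + gradV f₀ x (specRefl x v) ᵥ* dyad x (specRefl x v)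

/-- Backward exit time `sup {s ≥ 0 : x - s v ∈ Ω}`. It is `∞` for `v = 0`, `x ∈ Ω`, and `0` if the
set is empty, in particular on the incoming set. -/
def tb (x v : Plane) : ℝ≥0∞ :=
  ⨆ (s : ℝ≥0) (_ : x - (s : ℝ) • v ∈ disk), (s : ℝ≥0∞)

/-- The backward bounces `(tᵏ, xᵏ, vᵏ)`, starting from `(t⁰, x⁰, v⁰) = (t, x, v)`. Times are
extended reals, so that `t¹ = -∞` for a particle at rest. -/
def bounce (t : ℝ) (x v : Plane) : ℕ → EReal × Plane × Plane
  | 0 => ((t : EReal), x, v)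
  | k + 1 =>
    let p := bounce t x v k
    let b := tb p.2.1 p.2.2
    let y := p.2.1 - b.toReal • p.2.2
    (p.1 - (b : EReal), y, specRefl y p.2.2)

/-- `tᵏ(t, x, v)`. -/
def tk (t : ℝ) (x v : Plane) (k : ℕ) : EReal := (bounce t x v k).1

/-- `xᵏ(x, v)` (the value does not depend on `t`). -/
def xk (t : ℝ) (x v : Plane) (k : ℕ) : Plane := (bounce t x v k).2.1

/-- `vᵏ(x, v)` (the value does not depend on `t`). -/
def vk (t : ℝ) (x v : Plane) (k : ℕ) : Plane := (bounce t x v k).2.2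

/-- Position `X(s; t, x, v) = ∑ₖ 𝟏_{(tᵏ⁺¹, tᵏ]}(s) (xᵏ - (tᵏ - s) vᵏ)` of the specular
characteristic. -/
def charX (s t : ℝ) (x v : Plane) : Plane :=
  ∑ᶠ k : ℕ, (Ioc (tk t x v (k + 1)) (tk t x v k)).indicator
    (fun _ => xk t x v k - ((tk t x v k).toReal - s) • vk t x v k) (s : EReal)

/-- Velocity `V(s; t, x, v) = ∑ₖ 𝟏_{(tᵏ⁺¹, tᵏ]}(s) vᵏ` of the specular characteristic. -/
def charV (s t : ℝ) (x v : Plane) : Plane :=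
  ∑ᶠ k : ℕ, (Ioc (tk t x v (k + 1)) (tk t x v k)).indicator
    (fun _ => vk t x v k) (s : EReal)

/-- The mild solution `f(t, x, v) = f₀(X(0; t, x, v), V(0; t, x, v))`. -/
def mild (f₀ : Plane × Plane → ℝ) (p : ℝ × Plane × Plane) : ℝ :=
  f₀ (charX 0 p.1 p.2.1 p.2.2, charV 0 p.1 p.2.1 p.2.2)

/-- `g` is a `C¹(ℝ₊ × 𝓘)` solution of the free transport equation in the disk with specular
reflection and initial datum `f₀`. -/
structure IsC1Solution (f₀ : Plane × Plane → ℝ) (g : ℝ × Plane × Plane → ℝ) : Prop where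
  /-- `g` is of class `C¹` on `ℝ₊ × 𝓘`, up to the boundary. -/
  contDiffOn : ContDiffOn ℝ 1 g timePhase
  /-- `∂ₜ g + v · ∇ₓ g = 0` for `t > 0`, `x ∈ Ω`. -/
  transport : ∀ t : ℝ, 0 < t → ∀ x ∈ disk, ∀ v : Plane,
    deriv (fun s : ℝ => g (s, x, v)) t + fderiv ℝ (fun y : Plane => g (t, y, v)) x v = 0
  /-- Specular reflection. -/
  specular : ∀ t : ℝ, 0 ≤ t → ∀ x ∈ circ, ∀ v : Plane, g (t, x, v) = g (t, x, specRefl x v)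
  /-- Initial condition. -/
  initial : ∀ p ∈ nonGrazing, g (0, p) = f₀ p

end DiskTransport

end

open DiskTransport

noncomputable section
namespace DiskTransport

/-! ### Specular reflection -/

/-! A state is treated as a parametrized line. Off the tangential lines, the map `unfold`, which
reflects the whole line at its entry point and keeps its clock, is `C¹` on the open set `crossing`.
It can be iterated without asking whether the base point lies in the disk. So `backward k`, free
transport followed by `k` unfoldings, is a `C¹` map given by one formula, and its clock is explicit:
`exitTime_backward` gives `exitTime - t + k * chordTime`. By `bounce_spec` these lines are the
bounces of the statement, and `mild_eq` shows that `f = f₀ ∘ backward k` wherever `backward k p`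
lies in the closed disk. When a bounce falls at time `0`, both `k` and `k + 1` are admissible, by
the boundary condition on `f₀`.

Hence near each point with `v ≠ 0` either one branch suffices, or two consecutive branches meet
along `exitTime (backward k ·) = 0`. There the chain rule gives the two derivatives `Df₀(b) ∘ D` and
`Df₀(unfold b) ∘ Dunfold(b) ∘ D`, where `b = backward k p` is incoming and `D` is the derivative of
`backward k`. Since `D` is surjective, they agree iff `Df₀(b) = Df₀(unfold b) ∘ Dunfold(b)`. The
velocity half of this identity is the differentiated boundary condition; by `fderiv_unfold_apply`
and `specRefl_dyadApply` the position half is (C). This is `compatAt_iff`.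

If (C) holds, the branches glue to a `C¹` function (`contDiffOn_one_of_glue`). Conversely, both
sides of the interface accumulate at the point, so a continuous derivative must equal both branch
derivatives, which forces (C). Uniqueness holds because solutions are constant along segments and
can be traced back through finitely many bounces. -/

lemma specRefl_eq (x v : Plane) : specRefl x v = v - (2 * inner ℝ v x) • x := by
  ext i
  fin_cases i <;>
    simp [specRefl, reflMat, Matrix.vecMulVec, Fin.sum_univ_two,
      PiLp.inner_apply] <;> ring

lemma inner_specRefl_self {x : Plane} (hx : ‖x‖ = 1) (v : Plane) :
    inner ℝ (specRefl x v) x = -inner ℝ v x := by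
  rw [specRefl_eq, inner_sub_left, real_inner_smul_left, real_inner_self_eq_norm_sq, hx]
  ring

lemma specRefl_specRefl {x : Plane} (hx : ‖x‖ = 1) (v : Plane) :
    specRefl x (specRefl x v) = v := by
  rw [specRefl_eq x (specRefl x v), inner_specRefl_self hx, specRefl_eq]
  module

lemma norm_sq_specRefl {x : Plane} (hx : ‖x‖ = 1) (v : Plane) :
    ‖specRefl x v‖ ^ 2 = ‖v‖ ^ 2 := by
  rw [specRefl_eq, norm_sub_sq_real, real_inner_smul_right, norm_smul, mul_pow, hx,
    Real.norm_eq_abs, sq_abs]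
  ring

lemma specRefl_neg (x v : Plane) : specRefl x (-v) = -specRefl x v := by
  rw [specRefl_eq, specRefl_eq, inner_neg_left]
  module

lemma specRefl_of_inner_eq_zero {x v : Plane} (h : inner ℝ v x = 0) : specRefl x v = v := by
  rw [specRefl_eq, h]; simp

/-! ### Lines crossing the disk -/

/-- The reduced discriminant of the quadratic equation `‖x - s v‖² = 1` in `s`. -/
def discr (z : Plane × Plane) : ℝ := inner ℝ z.2 z.1 ^ 2 + ‖z.2‖ ^ 2 * (1 - ‖z.1‖ ^ 2)

/-- The pairs `(x, v)` for which the line through `x` with direction `v` crosses the open disk. -/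
def crossing : Set (Plane × Plane) := {z | 0 < discr z}

/-- The larger root `s` of `‖x - s v‖ = 1`. -/
def exitTime (z : Plane × Plane) : ℝ := (inner ℝ z.2 z.1 + √(discr z)) / ‖z.2‖ ^ 2

/-- The time a particle with velocity `v` needs to cross the disk. -/
def chordTime (z : Plane × Plane) : ℝ := 2 * √(discr z) / ‖z.2‖ ^ 2

/-- The point through which the line enters the disk. -/
def entry (z : Plane × Plane) : Plane := z.1 - exitTime z • z.2

/-- Specular reflection of the whole line at its entry point, leaving the time parameter of the
motion unchanged. -/
def unfold (z : Plane × Plane) : Plane × Plane :=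
  (entry z + exitTime z • specRefl (entry z) z.2, specRefl (entry z) z.2)

variable {z : Plane × Plane} {x v : Plane}

lemma norm_sq_pos_of_crossing (hz : z ∈ crossing) : 0 < ‖z.2‖ ^ 2 := by
  have h : z.2 ≠ 0 := by
    intro h
    have : 0 < discr z := hz
    simp [discr, h] at this
  positivity

lemma norm_ne_zero_of_crossing (hz : z ∈ crossing) : ‖z.2‖ ≠ 0 :=
  fun h => by simpa [h] using norm_sq_pos_of_crossing hz

lemma sqrt_discr_pos (hz : z ∈ crossing) : 0 < √(discr z) := Real.sqrt_pos.2 hz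

lemma sq_sqrt_discr (hz : z ∈ crossing) : √(discr z) ^ 2 = discr z :=
  Real.sq_sqrt (le_of_lt hz)

lemma chordTime_pos (hz : z ∈ crossing) : 0 < chordTime z := by
  have := norm_sq_pos_of_crossing hz
  have := sqrt_discr_pos hz
  unfold chordTime
  positivity

/-- In the plane the discriminant equals `‖v‖² - det(x, v)²`, which depends only on the velocity and
the line, not on the base point. -/
lemma discr_shift (x v : Plane) (s : ℝ) : discr (x - s • v, v) = discr (x, v) := by
  simp only [discr, inner_sub_right, norm_sub_sq_real, real_inner_smul_right, norm_smul, mul_pow,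
    Real.norm_eq_abs, sq_abs, real_inner_self_eq_norm_sq, real_inner_comm x v]
  ring

lemma chordTime_shift (x v : Plane) (s : ℝ) : chordTime (x - s • v, v) = chordTime (x, v) := by
  simp only [chordTime, discr_shift]

lemma crossing_shift {s : ℝ} : (x - s • v, v) ∈ crossing ↔ (x, v) ∈ crossing := by
  simp only [crossing, mem_ofPred_eq, discr_shift]

lemma exitTime_shift (h : (x, v) ∈ crossing) (s : ℝ) :
    exitTime (x - s • v, v) = exitTime (x, v) - s := by
  have hv : ‖v‖ ≠ 0 := norm_ne_zero_of_crossing (z := (x, v)) h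
  simp only [exitTime, discr_shift, inner_sub_right, real_inner_smul_right,
    real_inner_self_eq_norm_sq]
  field_simp
  ring

lemma entry_shift (h : (x, v) ∈ crossing) (s : ℝ) : entry (x - s • v, v) = entry (x, v) := by
  simp only [entry, exitTime_shift h]
  module

/-- The quadratic in `s` factors through its two roots; every question of lying in the disk becomes
a sign of this product. -/
lemma norm_sq_shift_sub_one (h : (x, v) ∈ crossing) (s : ℝ) :
    ‖x - s • v‖ ^ 2 - 1 = ‖v‖ ^ 2 * ((s - exitTime (x, v)) *
      (s - (exitTime (x, v) - chordTime (x, v)))) := by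
  have hv : ‖v‖ ≠ 0 := norm_ne_zero_of_crossing (z := (x, v)) h
  have hd := sq_sqrt_discr h
  simp only [norm_sub_sq_real, real_inner_smul_right, norm_smul, mul_pow,
    Real.norm_eq_abs, sq_abs, exitTime, chordTime, real_inner_comm v x]
  have hd' : √(discr (x, v)) ^ 2 = inner ℝ v x ^ 2 + ‖v‖ ^ 2 * (1 - ‖x‖ ^ 2) := hd
  field_simp
  linear_combination hd'

lemma norm_entry (hz : z ∈ crossing) : ‖entry z‖ = 1 := by
  have h := norm_sq_shift_sub_one (x := z.1) (v := z.2) hz (exitTime z)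
  simp only [Prod.mk.eta, sub_self, zero_mul, mul_zero] at h
  have h2 : ‖entry z‖ ^ 2 = 1 := by rw [entry]; linarith
  nlinarith [norm_nonneg (entry z)]

lemma inner_entry (hz : z ∈ crossing) : inner ℝ z.2 (entry z) = -√(discr z) := by
  have hv : ‖z.2‖ ≠ 0 := norm_ne_zero_of_crossing hz
  simp only [entry, inner_sub_right, real_inner_smul_right, real_inner_self_eq_norm_sq, exitTime]
  field_simp
  ring

lemma mem_phase_iff : z ∈ phase ↔ ‖z.1‖ ≤ 1 := by simp [phase, closedDisk]

lemma norm_le_one_iff (h : z ∈ crossing) :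
    ‖z.1‖ ≤ 1 ↔ 0 ≤ exitTime z ∧ exitTime z ≤ chordTime z := by
  have h0 := norm_sq_shift_sub_one (x := z.1) (v := z.2) h 0
  simp only [zero_smul, sub_zero, Prod.mk.eta, zero_sub] at h0
  have hv := norm_sq_pos_of_crossing h
  have hl := chordTime_pos h
  have hn := norm_nonneg z.1
  constructor
  · intro h1
    have h2 : ‖z.2‖ ^ 2 * (exitTime z * (exitTime z - chordTime z)) ≤ 0 := by nlinarith
    have h3 : exitTime z * (exitTime z - chordTime z) ≤ 0 := by
      by_contra! h4
      nlinarith [mul_pos hv h4]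
    constructor <;> by_contra! h4 <;> nlinarith
  · rintro ⟨h1, h2⟩
    have h3 : ‖z.2‖ ^ 2 * (exitTime z * (chordTime z - exitTime z)) ≥ 0 :=
      mul_nonneg hv.le (mul_nonneg h1 (sub_nonneg.2 h2))
    nlinarith

lemma norm_lt_one_iff (h : z ∈ crossing) :
    ‖z.1‖ < 1 ↔ 0 < exitTime z ∧ exitTime z < chordTime z := by
  have h0 := norm_sq_shift_sub_one (x := z.1) (v := z.2) h 0
  simp only [zero_smul, sub_zero, Prod.mk.eta, zero_sub] at h0
  have hv := norm_sq_pos_of_crossing h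
  have hl := chordTime_pos h
  have hn := norm_nonneg z.1
  constructor
  · intro h1
    have h2 : ‖z.2‖ ^ 2 * (exitTime z * (exitTime z - chordTime z)) < 0 := by nlinarith
    have h3 : exitTime z * (exitTime z - chordTime z) < 0 := by
      by_contra! h4
      nlinarith [mul_nonneg hv.le h4]
    constructor <;> by_contra! h4 <;> nlinarith
  · rintro ⟨h1, h2⟩
    have h3 : ‖z.2‖ ^ 2 * (exitTime z * (chordTime z - exitTime z)) > 0 :=
      mul_pos hv (mul_pos h1 (sub_pos.2 h2))
    nlinarith

/-! ### The reflected line -/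

lemma discr_of_norm_eq_one {y w : Plane} (hy : ‖y‖ = 1) :
    discr (y, w) = inner ℝ w y ^ 2 := by
  simp [discr, hy]

lemma discr_reflect (hz : z ∈ crossing) :
    discr (entry z, specRefl (entry z) z.2) = discr z := by
  rw [discr_of_norm_eq_one (norm_entry hz), inner_specRefl_self (norm_entry hz),
    inner_entry hz, neg_neg, sq_sqrt_discr hz]

lemma unfold_eq_shift (z : Plane × Plane) : unfold z =
    (entry z - (-exitTime z) • specRefl (entry z) z.2, specRefl (entry z) z.2) := by
  simp [unfold]

lemma discr_unfold (hz : z ∈ crossing) : discr (unfold z) = discr z := by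
  rw [unfold_eq_shift, discr_shift, discr_reflect hz]

lemma unfold_mem_crossing (hz : z ∈ crossing) : unfold z ∈ crossing := by
  have : 0 < discr z := hz
  simpa only [crossing, mem_ofPred_eq, discr_unfold hz] using this

lemma reflect_mem_crossing (hz : z ∈ crossing) :
    (entry z, specRefl (entry z) z.2) ∈ crossing := by
  have : 0 < discr z := hz
  simpa only [crossing, mem_ofPred_eq, discr_reflect hz] using this

lemma norm_sq_unfold_snd (hz : z ∈ crossing) : ‖(unfold z).2‖ ^ 2 = ‖z.2‖ ^ 2 :=
  norm_sq_specRefl (norm_entry hz) _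

lemma chordTime_unfold (hz : z ∈ crossing) : chordTime (unfold z) = chordTime z := by
  rw [chordTime, chordTime, discr_unfold hz, norm_sq_unfold_snd hz]

lemma exitTime_reflect (hz : z ∈ crossing) :
    exitTime (entry z, specRefl (entry z) z.2) = chordTime z := by
  rw [exitTime, discr_reflect hz, norm_sq_specRefl (norm_entry hz),
    inner_specRefl_self (norm_entry hz), inner_entry hz, chordTime]
  ring

lemma chordTime_reflect (hz : z ∈ crossing) :
    chordTime (entry z, specRefl (entry z) z.2) = chordTime z := by
  rw [chordTime, chordTime, discr_reflect hz, norm_sq_specRefl (norm_entry hz)]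

/-- Reflection makes the entry point of the old line the far end of a chord of equal length, so one
more full crossing lies behind it. -/
lemma exitTime_unfold (hz : z ∈ crossing) :
    exitTime (unfold z) = exitTime z + chordTime z := by
  rw [unfold_eq_shift, exitTime_shift (reflect_mem_crossing hz), exitTime_reflect hz]
  ring

/-- Reversal of the velocity. -/
def reversal (z : Plane × Plane) : Plane × Plane := (z.1, -z.2)

lemma discr_reversal (z : Plane × Plane) : discr (reversal z) = discr z := by
  simp [discr, reversal]

lemma reversal_mem_crossing (hz : z ∈ crossing) : reversal z ∈ crossing := by
  have : 0 < discr z := hz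
  simpa only [crossing, mem_ofPred_eq, discr_reversal] using this

lemma exitTime_reversal (z : Plane × Plane) :
    exitTime (reversal z) = chordTime z - exitTime z := by
  simp only [exitTime, chordTime, discr_reversal]
  simp only [reversal, inner_neg_left, norm_neg]
  ring

/-- The conjugate of `unfold` by the reversal of velocities is its left inverse. -/
lemma reversal_unfold_reversal_unfold (hz : z ∈ crossing) :
    reversal (unfold (reversal (unfold z))) = z := by
  have h1 : exitTime (reversal (unfold z)) = -exitTime z := by
    rw [exitTime_reversal, exitTime_unfold hz, chordTime_unfold hz]; ring
  -- The reversed reflected line enters the disk at the same point, so the second reflection there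
  -- undoes the first.
  have h2 : entry (reversal (unfold z)) = entry z := by
    rw [entry, h1]; simp [reversal, unfold]
  have h3 : specRefl (entry z) (reversal (unfold z)).2 = -z.2 := by
    simp [reversal, unfold, specRefl_neg, specRefl_specRefl (norm_entry hz)]
  rw [unfold, h2, h1, h3]
  ext1 <;> simp [reversal, entry]

variable {t s : ℝ} {k : ℕ} {f₀ : Plane × Plane → ℝ}

/-! ### The backward exit time and the bounces -/

lemma mem_crossing_of_nonGrazing (hz : z ∈ nonGrazing) (hv : z.2 ≠ 0) : z ∈ crossing := by
  have h1 : ‖z.1‖ ≤ 1 := mem_phase_iff.1 hz.1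
  have hv' : 0 < ‖z.2‖ ^ 2 := by positivity
  rcases h1.lt_or_eq with h | h
  · have : 0 < 1 - ‖z.1‖ ^ 2 := by nlinarith [norm_nonneg z.1]
    show 0 < inner ℝ z.2 z.1 ^ 2 + ‖z.2‖ ^ 2 * (1 - ‖z.1‖ ^ 2)
    positivity
  · have h2 : inner ℝ z.2 z.1 ≠ 0 := fun h0 => hz.2 ⟨h, h0⟩
    show 0 < discr (z.1, z.2)
    rw [discr_of_norm_eq_one h]
    positivity

lemma nonGrazing_of_mem_crossing (hz : z ∈ crossing) (hp : z ∈ phase) : z ∈ nonGrazing := by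
  refine ⟨hp, fun h => ?_⟩
  have h1 : 0 < discr (z.1, z.2) := hz
  rw [discr_of_norm_eq_one h.1, h.2] at h1
  simp at h1

lemma norm_lt_one_of_nonGrazing (hz : z ∈ nonGrazing) (hv : z.2 = 0) : ‖z.1‖ < 1 :=
  lt_of_le_of_ne (mem_phase_iff.1 hz.1) fun h => hz.2 ⟨h, by simp [hv]⟩

/-- On the incoming set both sides vanish: the supremum is over the empty set and the larger root is
`0`. -/
lemma tb_eq_of_crossing (hz : z ∈ crossing) (hp : z ∈ phase) :
    tb z.1 z.2 = ENNReal.ofReal (exitTime z) := by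
  obtain ⟨h0, h1⟩ := (norm_le_one_iff hz).1 (mem_phase_iff.1 hp)
  have key : ∀ s : ℝ, z.1 - s • z.2 ∈ disk ↔
      0 < exitTime z - s ∧ exitTime z - s < chordTime z := by
    intro s
    have h := norm_lt_one_iff (z := (z.1 - s • z.2, z.2)) (crossing_shift.2 hz)
    rw [exitTime_shift hz, chordTime_shift] at h
    exact h
  apply le_antisymm
  · refine iSup₂_le fun s hs => ?_
    rw [← ENNReal.ofReal_coe_nnreal]
    exact ENNReal.ofReal_le_ofReal (by linarith [((key s).1 hs).1])
  · refine le_of_forall_lt fun c hc => ?_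
    have hc' : c ≠ ⊤ := (hc.trans ENNReal.ofReal_lt_top).ne
    lift c to ℝ≥0 using hc'
    rw [← ENNReal.ofReal_coe_nnreal, ENNReal.ofReal_lt_ofReal_iff'] at hc
    obtain ⟨hc, hpos⟩ := hc
    -- The midpoint of `c` and the exit time is a strictly positive time before the exit, hence the
    -- point there is interior even if the start is on the circle.
    have hm : 0 ≤ ((c : ℝ) + exitTime z) / 2 := by positivity
    refine lt_of_lt_of_le ?_ (le_iSup₂_of_le (Real.toNNReal (((c : ℝ) + exitTime z) / 2)) ?_ le_rfl)
    · rw [ENNReal.coe_lt_coe, Real.lt_toNNReal_iff_coe_lt]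
      linarith
    · rw [Real.coe_toNNReal _ hm, key]
      constructor
      · linarith
      · have : (0 : ℝ) ≤ c := c.2
        linarith

lemma tk_antitone (t : ℝ) (x v : Plane) : Antitone (tk t x v) := by
  refine antitone_nat_of_succ_le fun k => ?_
  show (bounce t x v k).1 - _ ≤ (bounce t x v k).1
  exact EReal.sub_le_of_le_add' (le_add_of_nonneg_left (EReal.coe_ennreal_nonneg _))

lemma finsum_indicator_tk {w : ℕ → Plane} (h1 : tk t x v (k + 1) < s) (h2 : s ≤ tk t x v k) :
    ∑ᶠ j : ℕ, (Ioc (tk t x v (j + 1)) (tk t x v j)).indicator (fun _ => w j) (s : EReal) = w k := by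
  rw [finsum_eq_single _ k]
  · exact indicator_of_mem (mem_Ioc.2 ⟨h1, h2⟩) _
  · intro j hj
    refine indicator_of_notMem (fun h => ?_) _
    rcases lt_or_gt_of_ne hj with hjk | hjk
    · exact absurd (h2.trans (tk_antitone t x v hjk)) (not_le.2 h.1)
    · exact absurd (h.2.trans (tk_antitone t x v hjk)) (not_le.2 h1)

lemma mild_of_tk (h1 : tk t x v (k + 1) < 0) (h2 : 0 ≤ tk t x v k) :
    mild f₀ (t, x, v) =
      f₀ (xk t x v k - (tk t x v k).toReal • vk t x v k, vk t x v k) := by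
  have e1 : charX 0 t x v = xk t x v k - ((tk t x v k).toReal - 0) • vk t x v k :=
    finsum_indicator_tk (w := fun k => xk t x v k - ((tk t x v k).toReal - 0) • vk t x v k)
      (by simpa using h1) (by simpa using h2)
  have e2 : charV 0 t x v = vk t x v k :=
    finsum_indicator_tk (by simpa using h1) (by simpa using h2)
  rw [mild, e1, e2, sub_zero]

/-- The line reached from `(x, v)` after `k` backward bounces, parametrized so that it is at its
base point at time `0`. -/
def backward (k : ℕ) (p : ℝ × Plane × Plane) : Plane × Plane :=
  unfold^[k] (p.2.1 - p.1 • p.2.2, p.2.2)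

lemma backward_zero (p : ℝ × Plane × Plane) :
    backward 0 p = (p.2.1 - p.1 • p.2.2, p.2.2) := rfl

lemma backward_succ (k : ℕ) (p : ℝ × Plane × Plane) :
    backward (k + 1) p = unfold (backward k p) :=
  Function.iterate_succ_apply' _ _ _

lemma backward_mem_crossing {p : ℝ × Plane × Plane} (hp : p.2 ∈ crossing) (k : ℕ) :
    backward k p ∈ crossing := by
  induction k with
  | zero => exact crossing_shift.2 hp
  | succ k ih => rw [backward_succ]; exact unfold_mem_crossing ih

lemma chordTime_backward {p : ℝ × Plane × Plane} (hp : p.2 ∈ crossing) (k : ℕ) :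
    chordTime (backward k p) = chordTime p.2 := by
  induction k with
  | zero => exact chordTime_shift _ _ _
  | succ k ih => rw [backward_succ, chordTime_unfold (backward_mem_crossing hp k), ih]

lemma exitTime_backward {p : ℝ × Plane × Plane} (hp : p.2 ∈ crossing) (k : ℕ) :
    exitTime (backward k p) = exitTime p.2 - p.1 + k * chordTime p.2 := by
  induction k with
  | zero =>
    simp only [Nat.cast_zero, zero_mul, add_zero]
    exact exitTime_shift hp _
  | succ k ih =>
    rw [backward_succ, exitTime_unfold (backward_mem_crossing hp k), ih, chordTime_backward hp]
    push_cast
    ring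

lemma bounce_succ_of_real (hs : (bounce t x v k).1 = (s : EReal))
    (hz : (bounce t x v k).2 ∈ crossing) (hp : (bounce t x v k).2 ∈ phase) :
    bounce t x v (k + 1) = (((s - exitTime (bounce t x v k).2 : ℝ) : EReal),
      entry (bounce t x v k).2, specRefl (entry (bounce t x v k).2) (bounce t x v k).2.2) := by
  obtain ⟨h0, -⟩ := (norm_le_one_iff hz).1 (mem_phase_iff.1 hp)
  rw [bounce]
  simp only [tb_eq_of_crossing hz hp, hs, ENNReal.toReal_ofReal h0]
  rw [EReal.coe_ennreal_ofReal, max_eq_left h0, ← EReal.coe_sub]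
  rfl

/-- Sliding the `k`-th bounce along its velocity to time `0` gives the `k`-th unfolded line, because
entry points are unaffected by sliding. In particular all bounce times are finite. -/
lemma bounce_spec (hz : (x, v) ∈ crossing) (hp : (x, v) ∈ phase) (t : ℝ) (k : ℕ) :
    ∃ s : ℝ, (bounce t x v k).1 = s ∧ (bounce t x v k).2 ∈ crossing ∧
      (bounce t x v k).2 ∈ phase ∧
      ((bounce t x v k).2.1 - s • (bounce t x v k).2.2, (bounce t x v k).2.2) =
        backward k (t, x, v) := by
  induction k with
  | zero => exact ⟨t, rfl, hz, hp, rfl⟩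
  | succ k ih =>
    obtain ⟨s, hs, h1, h2, h3⟩ := ih
    rw [bounce_succ_of_real hs h1 h2, backward_succ, ← h3]
    refine ⟨_, rfl, reflect_mem_crossing h1, mem_phase_iff.2 (norm_entry h1).le, ?_⟩
    rw [unfold, entry_shift h1, exitTime_shift h1]
    ext1
    · simp only [Prod.mk.eta]; module
    · rfl

lemma vk_eq_of_crossing (hz : (x, v) ∈ crossing) (hp : (x, v) ∈ phase) (t : ℝ) (k : ℕ) :
    vk t x v k = (backward k (t, x, v)).2 := by
  obtain ⟨s, hs, h1, h2, h3⟩ := bounce_spec hz hp t k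
  rw [← h3]; rfl

lemma tk_succ_of_crossing (hz : (x, v) ∈ crossing) (hp : (x, v) ∈ phase) (t : ℝ) (k : ℕ) :
    tk t x v (k + 1) = ((-exitTime (backward k (t, x, v)) : ℝ) : EReal) := by
  obtain ⟨s, hs, h1, h2, h3⟩ := bounce_spec hz hp t k
  rw [← h3, exitTime_shift h1, tk, bounce_succ_of_real hs h1 h2]
  simp

lemma xk_succ_of_crossing (hz : (x, v) ∈ crossing) (hp : (x, v) ∈ phase) (t : ℝ) (k : ℕ) :
    xk t x v (k + 1) = entry (backward k (t, x, v)) := by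
  obtain ⟨s, hs, h1, h2, h3⟩ := bounce_spec hz hp t k
  rw [← h3, entry_shift h1, xk, bounce_succ_of_real hs h1 h2]

/-! ### The mild solution along lines -/

/-- The two bounds on the clock of the `k`-th line say exactly `tᵏ⁺¹ < 0 ≤ tᵏ`, so the sum defining
the characteristic selects index `k`. -/
lemma mild_of_exitTime_pos {p : ℝ × Plane × Plane} (hp : p ∈ timePhase) (hc : p.2 ∈ crossing)
    (hk : backward k p ∈ phase) (hpos : 0 < exitTime (backward k p)) :
    mild f₀ p = f₀ (backward k p) := by
  obtain ⟨t, x, v⟩ := p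
  have ht : 0 ≤ t := hp.1
  have hxv : (x, v) ∈ phase := hp.2.1
  have h1 : tk t x v (k + 1) < 0 := by
    rw [tk_succ_of_crossing hc hxv]
    exact_mod_cast neg_neg_iff_pos.2 hpos
  have h2 : 0 ≤ tk t x v k := by
    cases k with
    | zero => exact EReal.coe_nonneg.2 ht
    | succ k =>
      rw [tk_succ_of_crossing hc hxv]
      have h := ((norm_le_one_iff (backward_mem_crossing hc _)).1 (mem_phase_iff.1 hk)).2
      rw [backward_succ, exitTime_unfold (backward_mem_crossing hc _),
        chordTime_unfold (backward_mem_crossing hc _)] at h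
      have h' : 0 ≤ -exitTime (backward k (t, x, v)) := by linarith
      exact_mod_cast h'
  obtain ⟨s, hs, -, -, h3⟩ := bounce_spec hc hxv t k
  rw [mild_of_tk h1 h2, ← h3]
  simp only [tk, xk, vk, hs, EReal.toReal_coe]

lemma entry_of_exitTime_eq_zero (h : exitTime z = 0) : entry z = z.1 := by simp [entry, h]

lemma unfold_of_exitTime_eq_zero (h : exitTime z = 0) : unfold z = (z.1, specRefl z.1 z.2) := by
  simp [unfold, entry_of_exitTime_eq_zero h, h]

lemma mem_gammaMinus_of_exitTime_eq_zero (hz : z ∈ crossing) (h : exitTime z = 0) :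
    z ∈ gammaMinus := by
  have h1 := norm_entry hz
  have h2 := inner_entry hz
  have h3 := sqrt_discr_pos hz
  rw [entry_of_exitTime_eq_zero h] at h1 h2
  exact ⟨h1, by linarith⟩

/-- The mild solution is `f₀` evaluated at the base point of any of the reflected lines that lies
in the closed disk. -/
lemma mild_eq (hBC : ∀ x ∈ circ, ∀ v : Plane, f₀ (x, v) = f₀ (x, specRefl x v))
    {p : ℝ × Plane × Plane} (hp : p ∈ timePhase) (hc : p.2 ∈ crossing)
    (hk : backward k p ∈ phase) : mild f₀ p = f₀ (backward k p) := by
  have hck := backward_mem_crossing hc k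
  obtain ⟨h0, -⟩ := (norm_le_one_iff hck).1 (mem_phase_iff.1 hk)
  rcases h0.lt_or_eq with h | h
  · exact mild_of_exitTime_pos hp hc hk h
  -- Here the bounce happens at time `0`. The half-open intervals `(tᵏ⁺¹, tᵏ]` then select index `k
  -- + 1`, and the boundary condition carries the value back to index `k`.
  · obtain ⟨h1, -⟩ := mem_gammaMinus_of_exitTime_eq_zero hck h.symm
    have h2 := unfold_of_exitTime_eq_zero h.symm
    rw [mild_of_exitTime_pos (k := k + 1) hp hc, backward_succ, h2, ← hBC _ h1]
    · rw [backward_succ, h2]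
      exact mem_phase_iff.2 h1.le
    · rw [backward_succ, exitTime_unfold hck, ← h, zero_add]
      exact chordTime_pos hck

lemma exists_backward_mem_phase {p : ℝ × Plane × Plane} (hp : p ∈ timePhase)
    (hc : p.2 ∈ crossing) :
    ∃ k, backward k p ∈ phase ∧ 0 < exitTime (backward k p) := by
  obtain ⟨h0, h1⟩ := (norm_le_one_iff hc).1 (mem_phase_iff.1 hp.2.1)
  have hl := chordTime_pos hc
  have ht : 0 ≤ p.1 := hp.1
  have hex : ∃ k : ℕ, 0 < exitTime p.2 - p.1 + k * chordTime p.2 := by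
    obtain ⟨n, hn⟩ := exists_nat_gt ((p.1 - exitTime p.2) / chordTime p.2)
    refine ⟨n, ?_⟩
    rw [div_lt_iff₀ hl] at hn
    linarith
  classical
  -- For the first line with positive clock, minimality bounds the clock by one chord time, which
  -- puts the base point in the closed disk.
  refine ⟨Nat.find hex, ?_, ?_⟩
  · rw [mem_phase_iff, norm_le_one_iff (backward_mem_crossing hc _), exitTime_backward hc,
      chordTime_backward hc]
    refine ⟨(Nat.find_spec hex).le, ?_⟩
    rcases h : Nat.find hex with _ | k
    · simp only [Nat.cast_zero, zero_mul, add_zero]; linarith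
    · have := Nat.find_min hex (m := k) (by omega)
      push_cast
      linarith
  · rw [exitTime_backward hc]
    exact Nat.find_spec hex

lemma tk_one_at_rest (t : ℝ) (hx : ‖x‖ < 1) : tk t x 0 1 < 0 := by
  have htb : tb x 0 = ⊤ := by
    refine ENNReal.eq_top_of_forall_nnreal_le fun r => ?_
    exact le_iSup₂_of_le r (by simpa [disk] using hx) le_rfl
  have : tk t x 0 1 = (t : EReal) - ((tb x 0 : ℝ≥0∞) : EReal) := rfl
  rw [this, htb]
  simp

lemma mild_at_rest (ht : 0 ≤ t) (hx : ‖x‖ < 1) : mild f₀ (t, x, 0) = f₀ (x, 0) := by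
  rw [mild_of_tk (k := 0) (tk_one_at_rest t hx) (EReal.coe_nonneg.2 ht)]
  simp [xk, vk, bounce]

/-- Before the first bounce the mild solution is given by free transport. -/
lemma mild_free (hBC : ∀ x ∈ circ, ∀ v : Plane, f₀ (x, v) = f₀ (x, specRefl x v))
    {p : ℝ × Plane × Plane} (hp : p ∈ timePhase) (h : ‖p.2.1 - p.1 • p.2.2‖ ≤ 1) :
    mild f₀ p = f₀ (p.2.1 - p.1 • p.2.2, p.2.2) := by
  by_cases hv : p.2.2 = 0
  · obtain ⟨t, x, v⟩ := p
    have : v = 0 := hv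
    subst this
    rw [mild_at_rest hp.1 (norm_lt_one_of_nonGrazing hp.2 rfl)]
    simp
  · exact mild_eq (k := 0) hBC hp (mem_crossing_of_nonGrazing hp.2 hv) (mem_phase_iff.2 h)

/-! ### Smoothness of the reflected lines -/

lemma contDiff_discr : ContDiff ℝ 1 discr := by
  unfold discr
  exact ((contDiff_snd.inner ℝ contDiff_fst).pow 2).add
    ((contDiff_snd.norm_sq ℝ).mul (contDiff_const.sub (contDiff_fst.norm_sq ℝ)))

lemma isOpen_crossing : IsOpen crossing :=
  isOpen_lt continuous_const contDiff_discr.continuous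

/-- The square root is the only source of singularity, and it degenerates only at tangential lines
or zero velocity, both excluded by `crossing`. -/
lemma contDiffAt_sqrt_discr (hz : z ∈ crossing) : ContDiffAt ℝ 1 (fun z => √(discr z)) z :=
  contDiff_discr.contDiffAt.sqrt (ne_of_gt hz)

lemma contDiffAt_exitTime (hz : z ∈ crossing) : ContDiffAt ℝ 1 exitTime z := by
  unfold exitTime
  exact ((contDiff_snd.inner ℝ contDiff_fst).contDiffAt.add (contDiffAt_sqrt_discr hz)).div
    (contDiff_snd.norm_sq ℝ).contDiffAt (norm_sq_pos_of_crossing hz).ne'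

lemma contDiffAt_chordTime (hz : z ∈ crossing) : ContDiffAt ℝ 1 chordTime z := by
  unfold chordTime
  exact (contDiffAt_const.mul (contDiffAt_sqrt_discr hz)).div
    (contDiff_snd.norm_sq ℝ).contDiffAt (norm_sq_pos_of_crossing hz).ne'

lemma contDiffAt_entry (hz : z ∈ crossing) : ContDiffAt ℝ 1 entry z := by
  unfold entry
  exact contDiffAt_fst.sub ((contDiffAt_exitTime hz).smul contDiffAt_snd)

lemma contDiffAt_unfold (hz : z ∈ crossing) : ContDiffAt ℝ 1 unfold z := by
  have h : ContDiffAt ℝ 1 (fun z : Plane × Plane => specRefl (entry z) z.2) z := by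
    simp only [specRefl_eq]
    exact contDiffAt_snd.sub
      ((contDiffAt_const.mul (contDiffAt_snd.inner ℝ (contDiffAt_entry hz))).smul
        (contDiffAt_entry hz))
  exact ((contDiffAt_entry hz).add ((contDiffAt_exitTime hz).smul h)).prodMk h

lemma contDiffAt_backward {p : ℝ × Plane × Plane} (hp : p.2 ∈ crossing) (k : ℕ) :
    ContDiffAt ℝ 1 (backward k) p := by
  induction k with
  | zero =>
    have : ContDiff ℝ 1 (fun p : ℝ × Plane × Plane => (p.2.1 - p.1 • p.2.2, p.2.2)) := by
      fun_prop
    exact this.contDiffAt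
  | succ k ih =>
    have : backward (k + 1) = unfold ∘ backward k := funext (backward_succ k)
    rw [this]
    exact (contDiffAt_unfold (backward_mem_crossing hp k)).comp p ih

lemma hasFDerivAt_unfold (hz : z ∈ crossing) : HasFDerivAt unfold (fderiv ℝ unfold z) z :=
  ((contDiffAt_unfold hz).differentiableAt one_ne_zero).hasFDerivAt

lemma hasFDerivAt_backward {p : ℝ × Plane × Plane} (hp : p.2 ∈ crossing) (k : ℕ) :
    HasFDerivAt (backward k) (fderiv ℝ (backward k) p) p :=
  ((contDiffAt_backward hp k).differentiableAt one_ne_zero).hasFDerivAt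

lemma fderiv_backward_succ {p : ℝ × Plane × Plane} (hp : p.2 ∈ crossing) (k : ℕ) :
    fderiv ℝ (backward (k + 1)) p =
      (fderiv ℝ unfold (backward k p)).comp (fderiv ℝ (backward k) p) := by
  have : backward (k + 1) = unfold ∘ backward k := funext (backward_succ k)
  rw [this]
  exact ((hasFDerivAt_unfold (backward_mem_crossing hp k)).comp p
    (hasFDerivAt_backward hp k)).fderiv

/-- A differentiable left inverse makes the derivative injective, hence surjective in finite
dimension. Surjectivity is what later allows the common factor of two branch derivatives to be
cancelled. -/
lemma surjective_fderiv_unfold (hz : z ∈ crossing) : Function.Surjective (fderiv ℝ unfold z) := by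
  have hrev : ∀ z, HasFDerivAt reversal
      ((ContinuousLinearMap.fst ℝ Plane Plane).prod (-ContinuousLinearMap.snd ℝ Plane Plane)) z :=
    fun z => hasFDerivAt_fst.prodMk hasFDerivAt_snd.neg
  have h1 := (hasFDerivAt_unfold (reversal_mem_crossing (unfold_mem_crossing hz))).comp z
    ((hrev _).comp z (hasFDerivAt_unfold hz))
  have h2 := (hrev _).comp z h1
  have h3 : HasFDerivAt (fun z => reversal (unfold (reversal (unfold z))))
      (ContinuousLinearMap.id ℝ (Plane × Plane)) z :=
    (hasFDerivAt_id z).congr_of_eventuallyEq <| by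
      filter_upwards [isOpen_crossing.mem_nhds hz] with y hy
      exact reversal_unfold_reversal_unfold hy
  have h4 := h2.unique h3
  have hinj : Function.Injective (fderiv ℝ unfold z : (Plane × Plane) →ₗ[ℝ] Plane × Plane) := by
    intro a b hab
    have ha := congrArg (fun L => L a) h4
    have hb := congrArg (fun L => L b) h4
    have hab' : fderiv ℝ unfold z a = fderiv ℝ unfold z b := hab
    simp only [ContinuousLinearMap.comp_apply, hab'] at ha hb
    exact ha.symm.trans hb
  exact LinearMap.injective_iff_surjective.1 hinj

lemma surjective_fderiv_backward {p : ℝ × Plane × Plane} (hp : p.2 ∈ crossing) (k : ℕ) :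
    Function.Surjective (fderiv ℝ (backward k) p) := by
  induction k with
  | zero =>
    intro c
    -- The direction inverts the shear `(a, b) ↦ (a - t b, b)` of free transport at fixed time.
    have h1 : HasDerivAt (fun r : ℝ => backward 0 (p + r • ((0 : ℝ), c.1 + p.1 • c.2, c.2))) c 0 := by
      have e : (fun r : ℝ => backward 0 (p + r • ((0 : ℝ), c.1 + p.1 • c.2, c.2))) =
          fun r : ℝ => backward 0 p + r • c := by
        funext r
        ext1 <;> simp [backward]
        module
      rw [e]
      simpa using ((hasDerivAt_id (0 : ℝ)).smul_const c).const_add (backward 0 p)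
    refine ⟨((0 : ℝ), c.1 + p.1 • c.2, c.2), ?_⟩
    have h2 := (hasFDerivAt_backward hp 0).hasLineDerivAt (0, c.1 + p.1 • c.2, c.2)
    exact h2.unique h1
  | succ k ih =>
    rw [fderiv_backward_succ hp]
    exact (surjective_fderiv_unfold (backward_mem_crossing hp k)).comp ih

/-! ### The derivative of the reflection at incoming points -/

lemma gammaMinus_subset_crossing (hz : z ∈ gammaMinus) : z ∈ crossing := by
  show 0 < discr (z.1, z.2)
  rw [discr_of_norm_eq_one hz.1]
  exact sq_pos_of_ne_zero hz.2.ne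

lemma exitTime_of_gammaMinus (hz : z ∈ gammaMinus) : exitTime z = 0 := by
  have : √(discr (z.1, z.2)) = -inner ℝ z.2 z.1 := by
    rw [discr_of_norm_eq_one hz.1, Real.sqrt_sq_eq_abs, abs_of_neg hz.2]
  simp only [Prod.mk.eta] at this
  simp [exitTime, this]

/-- The variation of the velocity after reflection caused by the displacement `a` of the
position. -/
def velocityShift (y w a : Plane) : Plane :=
  -((2 * inner ℝ w (a - (inner ℝ a y / inner ℝ w y) • w)) • y) -
    (2 * inner ℝ w y) • (a - (inner ℝ a y / inner ℝ w y) • w)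

lemma fderiv_unfold_apply (hz : z ∈ gammaMinus) (a b : Plane) :
    fderiv ℝ unfold z (a, b) =
      (specRefl z.1 a, specRefl z.1 b + velocityShift z.1 z.2 a) := by
  have hc := gammaMinus_subset_crossing hz
  have h0 := exitTime_of_gammaMinus hz
  have he := entry_of_exitTime_eq_zero h0
  have hne : inner ℝ z.2 z.1 ≠ 0 := hz.2.ne
  have hcurve : HasDerivAt (fun r : ℝ => z + r • (a, b)) (a, b) 0 := by
    simpa using ((hasDerivAt_id (0 : ℝ)).smul_const (a, b)).const_add z
  have hc0 : z + (0 : ℝ) • (a, b) = z := by simp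
  have hfst : HasDerivAt (fun r : ℝ => (z + r • (a, b)).1) a 0 := by
    simpa using ((hasDerivAt_id (0 : ℝ)).smul_const a).const_add z.1
  have hsnd : HasDerivAt (fun r : ℝ => (z + r • (a, b)).2) b 0 := by
    simpa using ((hasDerivAt_id (0 : ℝ)).smul_const b).const_add z.2
  obtain ⟨τ', hτ⟩ : ∃ τ', HasDerivAt (fun r : ℝ => exitTime (z + r • (a, b))) τ' 0 :=
    ⟨_, ((contDiffAt_exitTime hc).differentiableAt one_ne_zero).hasFDerivAt.hasLineDerivAt (a, b)⟩
  have hent : HasDerivAt (fun r : ℝ => entry (z + r • (a, b))) (a - τ' • z.2) 0 := by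
    refine (hfst.sub (hτ.smul hsnd)).congr_deriv ?_
    rw [hc0, h0, zero_smul, zero_add]
  -- The entry point stays on the unit circle, so its derivative `a - τ' v` is tangent; this
  -- determines `τ'`.
  have hτ' : τ' = inner ℝ a z.1 / inner ℝ z.2 z.1 := by
    have h1 := hent.inner ℝ hent
    have h2 : HasDerivAt (fun r : ℝ => inner ℝ (entry (z + r • (a, b))) (entry (z + r • (a, b))))
        0 0 := by
      refine (hasDerivAt_const (0 : ℝ) (1 : ℝ)).congr_of_eventuallyEq ?_
      have hcont := hcurve.continuousAt
      have hmem : crossing ∈ nhds (z + (0 : ℝ) • (a, b)) := by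
        rw [hc0]; exact isOpen_crossing.mem_nhds hc
      filter_upwards [hcont hmem] with r hr
      rw [real_inner_self_eq_norm_sq, norm_entry hr, one_pow]
    have h3 := h1.unique h2
    simp only [hc0, he, inner_sub_left, inner_sub_right, real_inner_smul_left,
      real_inner_smul_right, real_inner_comm a z.1, real_inner_comm z.2 z.1] at h3
    rw [eq_div_iff hne]
    linarith
  have hrefl : HasDerivAt (fun r : ℝ => specRefl (entry (z + r • (a, b))) (z + r • (a, b)).2)
      (specRefl z.1 b + velocityShift z.1 z.2 a) 0 := by
    simp only [specRefl_eq]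
    refine (hsnd.sub (((hsnd.inner ℝ hent).const_mul 2).smul hent)).congr_deriv ?_
    rw [hc0, he, velocityShift, ← hτ']
    module
  have hun : HasDerivAt (fun r : ℝ => unfold (z + r • (a, b)))
      (specRefl z.1 a, specRefl z.1 b + velocityShift z.1 z.2 a) 0 := by
    refine HasDerivAt.prodMk ?_ hrefl
    refine (hent.add (hτ.smul hrefl)).congr_deriv ?_
    rw [hc0, he, h0, zero_smul, zero_add, specRefl_eq, specRefl_eq, hτ']
    -- With this product, `a - τ' v + τ' R v` collapses to `a - 2 (a · n) n = R a`.
    have : (inner ℝ a z.1 / inner ℝ z.2 z.1) * (2 * inner ℝ z.2 z.1) = 2 * inner ℝ a z.1 := by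
      field_simp
    rw [smul_sub, smul_smul, this]
    module
  exact ((hasFDerivAt_unfold hc).hasLineDerivAt (a, b)).unique hun

/-! ### The compatibility condition -/

/-- The vector `((Qw) ⊗ (Qw) / (w · n(y))) a`. -/
def dyadApply (y w a : Plane) : Plane := WithLp.toLp 2 (dyad y w *ᵥ a.ofLp)

/-- The counterclockwise rotation by `π / 2` of a vector. -/
def rot (w : Plane) : Plane := WithLp.toLp 2 (rotQ *ᵥ w.ofLp)

lemma dyadApply_eq (y w a : Plane) :
    dyadApply y w a = (inner ℝ (rot w) a / inner ℝ w y) • rot w := by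
  ext i
  simp only [dyadApply, dyad]
  fin_cases i <;>
    simp [rot, rotQ, Matrix.vecMulVec, Fin.sum_univ_two, PiLp.inner_apply] <;> ring

lemma rot_eq_add {y : Plane} (hy : ‖y‖ = 1) (w : Plane) :
    rot w = inner ℝ w y • rot y + inner ℝ (rot w) y • y := by
  have hy2 : y 0 ^ 2 + y 1 ^ 2 = 1 := by
    have := EuclideanSpace.real_norm_sq_eq y
    rw [hy, Fin.sum_univ_two] at this
    linarith
  ext i
  fin_cases i
  · simp [rot, rotQ, Matrix.vecHead, Matrix.vecTail, Fin.sum_univ_two, PiLp.inner_apply]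
    linear_combination w 1 * hy2
  · simp [rot, rotQ, Matrix.vecHead, Matrix.vecTail, Fin.sum_univ_two, PiLp.inner_apply]
    linear_combination -w 0 * hy2

/-- The left side is orthogonal to `y`, hence parallel to `rot y`. It describes the tangential
displacement of the entry point. -/
lemma inner_smul_sub_inner_smul (y w a : Plane) :
    inner ℝ w y • a - inner ℝ a y • w = inner ℝ (rot w) a • rot y := by
  ext i
  fin_cases i <;>
    simp [rot, rotQ, Matrix.vecHead, Matrix.vecTail, Fin.sum_univ_two, PiLp.inner_apply] <;> ring

lemma inner_rot_right (y w : Plane) : inner ℝ w (rot y) = -inner ℝ (rot w) y := by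
  simp [rot, rotQ, Matrix.vecHead, Matrix.vecTail, Fin.sum_univ_two, PiLp.inner_apply]

/-- A reflection reverses orientation, so it conjugates the quarter turn to its inverse. -/
lemma rot_specRefl {y : Plane} (hy : ‖y‖ = 1) (w : Plane) :
    rot (specRefl y w) = -specRefl y (rot w) := by
  have h1 : rot (specRefl y w) = rot w - (2 * inner ℝ w y) • rot y := by
    rw [specRefl_eq]
    ext i
    fin_cases i <;> simp [rot, rotQ, Matrix.vecHead, Matrix.vecTail]
  have h2 : (2 * inner ℝ w y) • rot y = (2 : ℝ) • (rot w - inner ℝ (rot w) y • y) := by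
    rw [sub_eq_of_eq_add (rot_eq_add hy w)]
    module
  rw [h1, h2, specRefl_eq]
  module

lemma inner_specRefl_specRefl {y : Plane} (hy : ‖y‖ = 1) (u w : Plane) :
    inner ℝ (specRefl y u) (specRefl y w) = inner ℝ u w := by
  simp only [specRefl_eq, inner_sub_left, inner_sub_right, real_inner_smul_left,
    real_inner_smul_right, real_inner_self_eq_norm_sq, hy, real_inner_comm w y]
  ring

lemma velocityShift_eq {y w : Plane} (hy : ‖y‖ = 1) (hw : inner ℝ w y ≠ 0) (a : Plane) :
    velocityShift y w a =
      -((2 * (inner ℝ (rot w) a / inner ℝ w y)) • specRefl y (rot w)) := by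
  have hd : a - (inner ℝ a y / inner ℝ w y) • w = (inner ℝ (rot w) a / inner ℝ w y) • rot y := by
    rw [div_eq_inv_mul, div_eq_inv_mul, mul_smul, mul_smul, ← inner_smul_sub_inner_smul, smul_sub,
      inv_smul_smul₀ hw]
  have hr : specRefl y (rot w) = inner ℝ w y • rot y - inner ℝ (rot w) y • y := by
    rw [specRefl_eq]
    nth_rw 1 [rot_eq_add hy w]
    module
  rw [velocityShift, hd, hr, real_inner_smul_right, inner_rot_right]
  module

/-- Under reflection the pairing with `rot w` and the denominator `w · n` both change sign, while
the remaining factor `rot w` contributes one minus sign. The reflected dyad is thus the negative of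
the conjugated one, and the discrepancy, twice the dyad term, is the velocity shift. -/
lemma specRefl_dyadApply {y w : Plane} (hy : ‖y‖ = 1) (hw : inner ℝ w y ≠ 0) (a : Plane) :
    dyadApply y (specRefl y w) (specRefl y a) =
      specRefl y (dyadApply y w a) + velocityShift y w a := by
  have hlin : ∀ (c : ℝ) (u : Plane), specRefl y (c • u) = c • specRefl y u := by
    intro c u
    simp only [specRefl_eq, real_inner_smul_left]
    module
  rw [dyadApply_eq, dyadApply_eq, rot_specRefl hy, inner_neg_left, inner_specRefl_specRefl hy,
    inner_specRefl_self hy, hlin, velocityShift_eq hy hw, neg_div_neg_eq]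
  module

lemma specRefl_mulVec (y a : Plane) : reflMat y *ᵥ a.ofLp = (specRefl y a).ofLp := rfl

lemma gradX_dotProduct (f₀ : Plane × Plane → ℝ) (y w a : Plane) :
    gradX f₀ y w ⬝ᵥ a.ofLp = fderivWithin ℝ f₀ phase (y, w) (a, 0) := by
  have ha : (a, (0 : Plane)) = a 0 • (EuclideanSpace.single 0 1, 0) +
      a 1 • (EuclideanSpace.single 1 1, 0) := by
    ext i
    · fin_cases i <;> simp
    · simp
  rw [ha, map_add, map_smul, map_smul, dotProduct, Fin.sum_univ_two]
  simp [gradX, mul_comm]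

lemma gradV_dotProduct (f₀ : Plane × Plane → ℝ) (y w a : Plane) :
    gradV f₀ y w ⬝ᵥ a.ofLp = fderivWithin ℝ f₀ phase (y, w) (0, a) := by
  have ha : ((0 : Plane), a) = a 0 • (0, EuclideanSpace.single 0 1) +
      a 1 • (0, EuclideanSpace.single 1 1) := by
    ext i
    · simp
    · fin_cases i <;> simp
  rw [ha, map_add, map_smul, map_smul, dotProduct, Fin.sum_univ_two]
  simp [gradV, mul_comm]

lemma compatAt_iff_forall {y w : Plane} (hy : ‖y‖ = 1) : CompatAt f₀ y w ↔ ∀ a : Plane,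
    fderivWithin ℝ f₀ phase (y, w) (a, 0) +
      fderivWithin ℝ f₀ phase (y, w) (0, dyadApply y w a) =
    fderivWithin ℝ f₀ phase (y, specRefl y w) (specRefl y a, 0) +
      fderivWithin ℝ f₀ phase (y, specRefl y w)
        (0, dyadApply y (specRefl y w) (specRefl y a)) := by
  have key : CompatAt f₀ y w ↔ ∀ a : Plane,
      ((gradX f₀ y w + gradV f₀ y w ᵥ* dyad y w) ᵥ* reflMat y) ⬝ᵥ (specRefl y a).ofLp =
      (gradX f₀ y (specRefl y w) + gradV f₀ y (specRefl y w) ᵥ* dyad y (specRefl y w)) ⬝ᵥ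
        (specRefl y a).ofLp := by
    refine ⟨fun h a => by rw [h], fun h => dotProduct_eq _ _ fun u => ?_⟩
    have := h (specRefl y (WithLp.toLp 2 u))
    rwa [specRefl_specRefl hy] at this
  rw [key]
  refine forall_congr' fun a => ?_
  rw [← Matrix.dotProduct_mulVec, specRefl_mulVec, specRefl_specRefl hy, add_dotProduct,
    add_dotProduct, ← Matrix.dotProduct_mulVec, ← Matrix.dotProduct_mulVec, ← gradX_dotProduct,
    ← gradX_dotProduct, ← gradV_dotProduct, ← gradV_dotProduct]
  rfl

/-- Differentiating the specular boundary condition in the velocity. -/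
lemma fderivWithin_velocity_specRefl (hf₀ : DifferentiableOn ℝ f₀ phase)
    (hBC : ∀ x ∈ circ, ∀ v : Plane, f₀ (x, v) = f₀ (x, specRefl x v))
    {y : Plane} (hy : ‖y‖ = 1) (w b : Plane) :
    fderivWithin ℝ f₀ phase (y, w) (0, b) =
      fderivWithin ℝ f₀ phase (y, specRefl y w) (0, specRefl y b) := by
  have hph : ∀ u : Plane, (y, u) ∈ phase := fun u => mem_phase_iff.2 hy.le
  have hlin : ∀ r : ℝ, specRefl y (w + r • b) = specRefl y w + r • specRefl y b := by
    intro r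
    simp only [specRefl_eq, inner_add_left, real_inner_smul_left]
    module
  have hder : ∀ u c : Plane, HasDerivAt (fun r : ℝ => f₀ (y, u + r • c))
      (fderivWithin ℝ f₀ phase (y, u) (0, c)) 0 := by
    intro u c
    have h1 : HasDerivAt (fun r : ℝ => (y, u + r • c)) ((0 : Plane), c) 0 := by
      refine (hasDerivAt_const _ _).prodMk ?_
      simpa using ((hasDerivAt_id (0 : ℝ)).smul_const c).const_add u
    have h2 : HasFDerivWithinAt f₀ (fderivWithin ℝ f₀ phase (y, u)) phase
        (y, u + (0 : ℝ) • c) := by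
      have := (hf₀ (y, u) (hph u)).hasFDerivWithinAt
      simpa using this
    have h3 := h2.comp_hasDerivWithinAt (s := univ) (0 : ℝ) h1.hasDerivWithinAt
      (fun r _ => hph _)
    exact hasDerivWithinAt_univ.1 h3
  refine (hder w b).unique ?_
  have e : (fun r : ℝ => f₀ (y, w + r • b)) =
      fun r : ℝ => f₀ (y, specRefl y w + r • specRefl y b) := by
    funext r
    rw [← hlin, ← hBC y hy]
  rw [e]
  exact hder _ _

/-- The compatibility condition says that the first derivatives of `f₀` and of its pullback by
the reflection of lines agree. -/
lemma compatAt_iff (hf₀ : DifferentiableOn ℝ f₀ phase)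
    (hBC : ∀ x ∈ circ, ∀ v : Plane, f₀ (x, v) = f₀ (x, specRefl x v)) (hz : z ∈ gammaMinus) :
    CompatAt f₀ z.1 z.2 ↔ fderivWithin ℝ f₀ phase z =
      (fderivWithin ℝ f₀ phase (unfold z)).comp (fderiv ℝ unfold z) := by
  have hy : ‖z.1‖ = 1 := hz.1
  have hu := unfold_of_exitTime_eq_zero (exitTime_of_gammaMinus hz)
  have hsplit : ∀ (L : Plane × Plane →L[ℝ] ℝ) (a b : Plane), L (a, b) = L (a, 0) + L (0, b) := by
    intro L a b
    rw [← map_add]; simp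
  have hE : (fderivWithin ℝ f₀ phase z =
      (fderivWithin ℝ f₀ phase (unfold z)).comp (fderiv ℝ unfold z)) ↔ ∀ a b : Plane,
      fderivWithin ℝ f₀ phase z (a, b) = fderivWithin ℝ f₀ phase (unfold z)
        (specRefl z.1 a, specRefl z.1 b + velocityShift z.1 z.2 a) := by
    constructor
    · intro h a b
      rw [← fderiv_unfold_apply hz a b, h]; rfl
    · intro h
      refine ContinuousLinearMap.ext fun c => ?_
      rw [ContinuousLinearMap.comp_apply]
      have := h c.1 c.2
      rwa [← fderiv_unfold_apply hz c.1 c.2] at this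
  rw [hE, compatAt_iff_forall hy]
  refine forall_congr' fun a => ?_
  rw [specRefl_dyadApply hy hz.2.ne, fderivWithin_velocity_specRefl hf₀ hBC hy, hu]
  set B := fderivWithin ℝ f₀ phase (z.1, specRefl z.1 z.2)
  -- The boundary condition already matches all velocity directions, so the identity for all `(a,
  -- b)` is equivalent to the one for `(a, 0)`.
  have hB : ∀ b, fderivWithin ℝ f₀ phase z (0, b) = B (0, specRefl z.1 b) :=
    fun b => fderivWithin_velocity_specRefl hf₀ hBC hy z.2 b
  have hadd : ∀ b c : Plane, B (0, b + c) = B (0, b) + B (0, c) := by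
    intro b c
    rw [← map_add]; simp
  have hz0 : fderivWithin ℝ f₀ phase (z.1, z.2) = fderivWithin ℝ f₀ phase z := rfl
  simp only [hz0, hadd]
  constructor
  · intro h b
    rw [hsplit _ a b, hsplit B, hB, hadd]
    linarith
  · intro h
    have := h 0
    rw [hsplit _ a 0, hsplit B, hB, hadd] at this
    linarith

/-- Since `R_y` is an involution, testing on `R_y a` exchanges the two sides of the condition. This
transfers it from incoming to outgoing points. -/
lemma CompatAt.specRefl {y w : Plane} (hy : ‖y‖ = 1) (h : CompatAt f₀ y w) :
    CompatAt f₀ y (specRefl y w) := by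
  rw [compatAt_iff_forall hy] at h ⊢
  intro a
  have := h (DiskTransport.specRefl y a)
  rw [specRefl_specRefl hy] at this
  rw [specRefl_specRefl hy]
  exact this.symm

/-! ### Gluing of `C¹` functions along a level set -/

section Glue

open Filter Topology

lemma nhdsWithin_inter_nonpos_eq_bot {E : Type*} [TopologicalSpace E] {S : Set E} {T : E → ℝ} {p : E}
    (hT : ContinuousWithinAt T S p) (hp : 0 < T p) : 𝓝[S ∩ {q | T q ≤ 0}] p = ⊥ := by
  rw [← empty_mem_iff_bot]
  have h1 : ∀ᶠ q in 𝓝[S ∩ {q | T q ≤ 0}] p, 0 < T q :=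
    (hT.eventually (lt_mem_nhds hp)).filter_mono (nhdsWithin_mono p inter_subset_left)
  filter_upwards [h1, self_mem_nhdsWithin] with q hq hq'
  exact absurd hq (not_lt.2 hq'.2)

variable {E F : Type*} [NormedAddCommGroup E] [NormedSpace ℝ E] [NormedAddCommGroup F]
  [NormedSpace ℝ F]

/-- A function which is of class `C¹` on both sides of the zero set of a continuous function, with
derivatives that agree there, is of class `C¹`. -/
lemma contDiffOn_one_of_glue {S : Set E} {T : E → ℝ} {f : E → F} {f₁ f₂ : E → E →L[ℝ] F}
    (hT : ContinuousOn T S)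
    (h₁ : ∀ p ∈ S ∩ {q | T q ≤ 0}, HasFDerivWithinAt f (f₁ p) (S ∩ {q | T q ≤ 0}) p)
    (h₂ : ∀ p ∈ S ∩ {q | 0 ≤ T q}, HasFDerivWithinAt f (f₂ p) (S ∩ {q | 0 ≤ T q}) p)
    (c₁ : ContinuousOn f₁ (S ∩ {q | T q ≤ 0})) (c₂ : ContinuousOn f₂ (S ∩ {q | 0 ≤ T q}))
    (heq : ∀ p ∈ S, T p = 0 → f₁ p = f₂ p) : ContDiffOn ℝ 1 f S := by
  classical
  set f' : E → E →L[ℝ] F := fun p => if T p ≤ 0 then f₁ p else f₂ p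
  have e₁ : EqOn f' f₁ (S ∩ {q | T q ≤ 0}) := fun p hp => if_pos hp.2
  have e₂ : EqOn f' f₂ (S ∩ {q | 0 ≤ T q}) := by
    intro p hp
    rcases (show 0 ≤ T p from hp.2).lt_or_eq with h | h
    · exact if_neg (not_le.2 h)
    · rw [e₁ ⟨hp.1, h.ge⟩, heq p hp.1 h.symm]
  have hS : S = (S ∩ {q | T q ≤ 0}) ∪ (S ∩ {q | 0 ≤ T q}) := by
    rw [← inter_union_distrib_left]
    refine (inter_eq_left.2 fun q _ => ?_).symm
    exact le_total (T q) 0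
  have hbot : ∀ p ∈ S, p ∉ S ∩ {q | T q ≤ 0} → 𝓝[S ∩ {q | T q ≤ 0}] p = ⊥ := by
    intro p hp hn
    exact nhdsWithin_inter_nonpos_eq_bot (hT p hp) (not_le.1 fun h => hn ⟨hp, h⟩)
  have hbot' : ∀ p ∈ S, p ∉ S ∩ {q | 0 ≤ T q} → 𝓝[S ∩ {q | 0 ≤ T q}] p = ⊥ := by
    intro p hp hn
    have := nhdsWithin_inter_nonpos_eq_bot (T := fun q => -T q) (hT p hp).neg
      (neg_pos.2 (not_le.1 fun h => hn ⟨hp, h⟩))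
    simpa only [Left.neg_nonpos_iff] using this
  -- Strictly on one side, the point is not in the closure of the other piece, so the condition
  -- there is vacuous.
  have hder : ∀ p ∈ S, HasFDerivWithinAt f (f' p) S p := by
    intro p hp
    rw [hS]
    apply HasFDerivWithinAt.union
    · by_cases h : p ∈ S ∩ {q | T q ≤ 0}
      · rw [e₁ h]; exact h₁ p h
      · exact HasFDerivWithinAt.of_notMem_closure
          (by rw [mem_closure_iff_nhdsWithin_neBot, hbot p hp h]; exact not_neBot.2 rfl)
    · by_cases h : p ∈ S ∩ {q | 0 ≤ T q}
      · rw [e₂ h]; exact h₂ p h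
      · exact HasFDerivWithinAt.of_notMem_closure
          (by rw [mem_closure_iff_nhdsWithin_neBot, hbot' p hp h]; exact not_neBot.2 rfl)
  have hcont : ContinuousOn f' S := by
    intro p hp
    rw [hS]
    apply ContinuousWithinAt.union
    · by_cases h : p ∈ S ∩ {q | T q ≤ 0}
      · exact (c₁.congr e₁) p h
      · rw [ContinuousWithinAt, hbot p hp h]; exact tendsto_bot
    · by_cases h : p ∈ S ∩ {q | 0 ≤ T q}
      · exact (c₂.congr e₂) p h
      · rw [ContinuousWithinAt, hbot' p hp h]; exact tendsto_bot
  have h01 : (1 : WithTop ℕ∞) = 0 + 1 := by simp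
  rw [h01, contDiffOn_succ_iff_hasFDerivWithinAt (by simp)]
  intro p hp
  refine ⟨S, ?_, by simp, f', hder, contDiffOn_zero.2 hcont⟩
  rw [insert_eq_of_mem hp]
  exact self_mem_nhdsWithin

end Glue

/-! ### Regularity of the mild solution -/

open Filter Topology

lemma phase_eq : phase = Metric.closedBall (0 : Plane) 1 ×ˢ univ := by
  ext z
  simp [phase, closedDisk]

lemma uniqueDiffOn_phase : UniqueDiffOn ℝ phase := by
  rw [phase_eq]
  refine UniqueDiffOn.prod (uniqueDiffOn_convex (convex_closedBall _ _) ?_) uniqueDiffOn_univ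
  rw [interior_closedBall _ one_ne_zero]
  exact Metric.nonempty_ball.2 one_pos

lemma isClosed_gammaZero : IsClosed gammaZero := by
  have h1 : IsClosed {p : Plane × Plane | ‖p.1‖ = 1} := isClosed_eq (by fun_prop) (by fun_prop)
  have h2 : IsClosed {p : Plane × Plane | inner ℝ p.2 p.1 = 0} :=
    isClosed_eq (by fun_prop) (by fun_prop)
  exact h1.inter h2

lemma uniqueDiffOn_timePhase : UniqueDiffOn ℝ timePhase := by
  refine (uniqueDiffOn_Ici 0).prod ?_
  rw [nonGrazing, sdiff_eq]
  exact uniqueDiffOn_phase.inter isClosed_gammaZero.isOpen_compl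

/-- The derivative of `f₀ ∘ backward k`. -/
def pullback (f₀ : Plane × Plane → ℝ) (k : ℕ) (p : ℝ × Plane × Plane) :
    ℝ × Plane × Plane →L[ℝ] ℝ :=
  (fderivWithin ℝ f₀ phase (backward k p)).comp (fderiv ℝ (backward k) p)

lemma hasFDerivWithinAt_mild (hf₀ : ContDiffOn ℝ 1 f₀ phase)
    (hBC : ∀ x ∈ circ, ∀ v : Plane, f₀ (x, v) = f₀ (x, specRefl x v))
    {A : Set (ℝ × Plane × Plane)} (hA : A ⊆ timePhase) (hc : ∀ p ∈ A, p.2 ∈ crossing)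
    (hm : MapsTo (backward k) A phase) {p : ℝ × Plane × Plane} (hp : p ∈ A) :
    HasFDerivWithinAt (mild f₀) (pullback f₀ k p) A p := by
  have h1 := ((hf₀.differentiableOn one_ne_zero) _ (hm hp)).hasFDerivWithinAt
  have h2 := (hasFDerivAt_backward (hc p hp) k).hasFDerivWithinAt (s := A)
  exact (h1.comp p h2 hm).congr (fun q hq => mild_eq hBC (hA hq) (hc q hq) (hm hq))
    (mild_eq hBC (hA hp) (hc p hp) (hm hp))

lemma continuousOn_pullback (hf₀ : ContDiffOn ℝ 1 f₀ phase)
    {A : Set (ℝ × Plane × Plane)} (hc : ∀ p ∈ A, p.2 ∈ crossing)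
    (hm : MapsTo (backward k) A phase) : ContinuousOn (pullback f₀ k) A := by
  have h1 : ContinuousOn (fderivWithin ℝ f₀ phase) phase :=
    hf₀.continuousOn_fderivWithin uniqueDiffOn_phase le_rfl
  have h2 : ContinuousOn (backward k) A := fun p hp =>
    (contDiffAt_backward (hc p hp) k).continuousAt.continuousWithinAt
  have h3 : ContinuousOn (fderiv ℝ (backward k)) A := fun p hp =>
    ((contDiffAt_backward (hc p hp) k).continuousAt_fderiv one_ne_zero).continuousWithinAt
  exact (h1.comp h2 hm).clm_comp h3

/-- By the chain rule both branch derivatives factor through the surjective derivative of `backward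
k`; cancelling it leaves `compatAt_iff`. -/
lemma pullback_succ_eq (hf₀ : ContDiffOn ℝ 1 f₀ phase)
    (hBC : ∀ x ∈ circ, ∀ v : Plane, f₀ (x, v) = f₀ (x, specRefl x v))
    {p : ℝ × Plane × Plane} (hp : p.2 ∈ crossing) (h0 : backward k p ∈ gammaMinus) :
    pullback f₀ (k + 1) p = pullback f₀ k p ↔
      CompatAt f₀ (backward k p).1 (backward k p).2 := by
  rw [compatAt_iff (hf₀.differentiableOn one_ne_zero) hBC h0, pullback, pullback,
    fderiv_backward_succ hp, backward_succ, ← ContinuousLinearMap.comp_assoc]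
  constructor
  · intro h
    refine ContinuousLinearMap.ext fun c => ?_
    obtain ⟨d, rfl⟩ := surjective_fderiv_backward hp k c
    exact (congrArg (fun L => L d) h).symm
  · intro h
    rw [← h]

lemma continuousAt_exitTime_backward {p : ℝ × Plane × Plane} (hp : p.2 ∈ crossing) (k : ℕ) :
    ContinuousAt (fun q => exitTime (backward k q)) p :=
  ContinuousAt.comp (f := backward k)
    (contDiffAt_exitTime (backward_mem_crossing hp k)).continuousAt
    (contDiffAt_backward hp k).continuousAt

lemma continuousAt_chordTime_snd {p : ℝ × Plane × Plane} (hp : p.2 ∈ crossing) :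
    ContinuousAt (fun q : ℝ × Plane × Plane => chordTime q.2) p :=
  ContinuousAt.comp (f := fun q : ℝ × Plane × Plane => q.2)
    (contDiffAt_chordTime hp).continuousAt continuousAt_snd

lemma eventually_crossing {p : ℝ × Plane × Plane} (hp : p.2 ∈ crossing) :
    ∀ᶠ q in 𝓝 p, q.2 ∈ crossing :=
  continuousAt_snd.eventually (isOpen_crossing.mem_nhds hp)

lemma backward_mem_phase_iff {p : ℝ × Plane × Plane} (hp : p.2 ∈ crossing) :
    backward k p ∈ phase ↔
      0 ≤ exitTime (backward k p) ∧ exitTime (backward k p) ≤ chordTime p.2 := by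
  rw [mem_phase_iff, norm_le_one_iff (backward_mem_crossing hp k), chordTime_backward hp]

lemma exitTime_backward_succ {p : ℝ × Plane × Plane} (hp : p.2 ∈ crossing) (k : ℕ) :
    exitTime (backward (k + 1) p) = exitTime (backward k p) + chordTime p.2 := by
  rw [exitTime_backward hp, exitTime_backward hp]
  push_cast
  ring

lemma exitTime_backward_zero_le {p : ℝ × Plane × Plane} (hp : p ∈ timePhase)
    (hc : p.2 ∈ crossing) : exitTime (backward 0 p) ≤ chordTime p.2 := by
  obtain ⟨-, h1⟩ := (norm_le_one_iff hc).1 (mem_phase_iff.1 hp.2.1)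
  have ht : 0 ≤ p.1 := hp.1
  rw [exitTime_backward hc]
  simp only [Nat.cast_zero, zero_mul, add_zero]
  linarith

lemma contDiffWithinAt_mild_of_free (hf₀ : ContDiffOn ℝ 1 f₀ phase)
    (hBC : ∀ x ∈ circ, ∀ v : Plane, f₀ (x, v) = f₀ (x, specRefl x v))
    {p : ℝ × Plane × Plane} (hp : p ∈ timePhase)
    (h : ∀ᶠ q in 𝓝[timePhase] p, ‖q.2.1 - q.1 • q.2.2‖ ≤ 1) :
    ContDiffWithinAt ℝ 1 (mild f₀) timePhase p := by
  set S : Set (ℝ × Plane × Plane) := {q ∈ timePhase | ‖q.2.1 - q.1 • q.2.2‖ ≤ 1}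
  have hS : S ∈ 𝓝[timePhase] p := by
    filter_upwards [h, self_mem_nhdsWithin] with q h1 h2 using ⟨h2, h1⟩
  have hφ : ContDiff ℝ 1 (fun q : ℝ × Plane × Plane => (q.2.1 - q.1 • q.2.2, q.2.2)) := by
    fun_prop
  have hd : ContDiffOn ℝ 1 (mild f₀) S := by
    refine (hf₀.comp hφ.contDiffOn (fun q hq => mem_phase_iff.2 hq.2)).congr fun q hq => ?_
    exact mild_free hBC hq.1 hq.2
  exact (hd p (mem_of_mem_nhdsWithin hp hS)).mono_of_mem_nhdsWithin hS

/-- The points whose backward trajectory is close to its `(k + 1)`-st bounce at time `0`: at that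
time it is on the `k`-th or on the `(k + 1)`-st reflected line. -/
def bounceZone (k : ℕ) : Set (ℝ × Plane × Plane) := {q ∈ timePhase | q.2 ∈ crossing ∧
  0 < exitTime (backward (k + 1) q) ∧ exitTime (backward k q) < chordTime q.2}

lemma bounceZone_mem_nhdsWithin {p : ℝ × Plane × Plane} (hp : p ∈ bounceZone k) :
    bounceZone k ∈ 𝓝[timePhase] p := by
  have ev1 := eventually_crossing hp.2.1
  have ev2 := (continuousAt_exitTime_backward hp.2.1 (k + 1)).eventually_const_lt hp.2.2.1
  have ev3 : ∀ᶠ q in 𝓝 p, exitTime (backward k q) < chordTime q.2 :=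
    (continuousAt_exitTime_backward hp.2.1 k).eventually_lt (continuousAt_chordTime_snd hp.2.1)
      hp.2.2.2
  filter_upwards [nhdsWithin_le_nhds ev1, nhdsWithin_le_nhds ev2, nhdsWithin_le_nhds ev3,
    self_mem_nhdsWithin] with q h1 h2 h3 h4 using ⟨h4, h1, h2, h3⟩

lemma mapsTo_backward_succ (k : ℕ) :
    MapsTo (backward (k + 1)) (bounceZone k ∩ {q | exitTime (backward k q) ≤ 0}) phase := by
  rintro q ⟨⟨-, h1, h2, -⟩, h4⟩
  refine (backward_mem_phase_iff h1).2 ⟨h2.le, ?_⟩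
  rw [exitTime_backward_succ h1]
  linarith [show exitTime (backward k q) ≤ 0 from h4]

lemma mapsTo_backward (k : ℕ) :
    MapsTo (backward k) (bounceZone k ∩ {q | 0 ≤ exitTime (backward k q)}) phase := by
  rintro q ⟨⟨-, h1, -, h3⟩, h4⟩
  exact (backward_mem_phase_iff h1).2 ⟨h4, h3.le⟩

lemma contDiffOn_mild_bounceZone (hf₀ : ContDiffOn ℝ 1 f₀ phase)
    (hBC : ∀ x ∈ circ, ∀ v : Plane, f₀ (x, v) = f₀ (x, specRefl x v))
    (hcomp : ∀ p ∈ gammaMinus, CompatAt f₀ p.1 p.2) (k : ℕ) :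
    ContDiffOn ℝ 1 (mild f₀) (bounceZone k) := by
  refine contDiffOn_one_of_glue (T := fun q => exitTime (backward k q))
    (f₁ := pullback f₀ (k + 1)) (f₂ := pullback f₀ k)
    (fun q hq => (continuousAt_exitTime_backward hq.2.1 k).continuousWithinAt)
    (fun q hq => hasFDerivWithinAt_mild hf₀ hBC (fun r hr => hr.1.1) (fun r hr => hr.1.2.1)
      (mapsTo_backward_succ k) hq)
    (fun q hq => hasFDerivWithinAt_mild hf₀ hBC (fun r hr => hr.1.1) (fun r hr => hr.1.2.1)
      (mapsTo_backward k) hq)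
    (continuousOn_pullback hf₀ (fun r hr => hr.1.2.1) (mapsTo_backward_succ k))
    (continuousOn_pullback hf₀ (fun r hr => hr.1.2.1) (mapsTo_backward k)) ?_
  intro q hq h0
  have hγ := mem_gammaMinus_of_exitTime_eq_zero (backward_mem_crossing hq.2.1 k) h0
  exact (pullback_succ_eq hf₀ hBC hq.2.1 hγ).2 (hcomp _ hγ)

theorem contDiffOn_mild (hf₀ : ContDiffOn ℝ 1 f₀ phase)
    (hBC : ∀ x ∈ circ, ∀ v : Plane, f₀ (x, v) = f₀ (x, specRefl x v))
    (hcomp : ∀ p ∈ gammaMinus, CompatAt f₀ p.1 p.2) : ContDiffOn ℝ 1 (mild f₀) timePhase := by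
  intro p hp
  by_cases hv : p.2.2 = 0
  · refine contDiffWithinAt_mild_of_free hf₀ hBC hp (nhdsWithin_le_nhds ?_)
    have hcont : Continuous (fun q : ℝ × Plane × Plane => ‖q.2.1 - q.1 • q.2.2‖) := by fun_prop
    have hlt : ‖p.2.1 - p.1 • p.2.2‖ < 1 := by
      simpa [hv] using norm_lt_one_of_nonGrazing hp.2 hv
    filter_upwards [hcont.continuousAt.eventually_lt_const hlt] with q hq using hq.le
  have hc := mem_crossing_of_nonGrazing hp.2 hv
  obtain ⟨k, hk, hpos⟩ := exists_backward_mem_phase hp hc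
  cases k with
  -- No gluing is needed: the clock of the unreflected line never exceeds the chord time in
  -- `timePhase`, so positivity alone keeps nearby base points in the closed disk.
  | zero =>
    refine contDiffWithinAt_mild_of_free hf₀ hBC hp ?_
    filter_upwards [nhdsWithin_le_nhds (eventually_crossing hc),
      nhdsWithin_le_nhds ((continuousAt_exitTime_backward hc 0).eventually_const_lt hpos),
      self_mem_nhdsWithin] with q h1 h2 h3
    have h4 : backward 0 q ∈ phase :=
      (backward_mem_phase_iff h1).2 ⟨h2.le, exitTime_backward_zero_le h3 h1⟩
    rw [mem_phase_iff, backward_zero] at h4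
    exact h4
  | succ j =>
    -- The clock of line `j` is one chord time less than that of line `j + 1`, hence at most `0`.
    have hj : exitTime (backward j p) < chordTime p.2 := by
      have h1 := ((backward_mem_phase_iff hc).1 hk).2
      have h2 := chordTime_pos hc
      rw [exitTime_backward_succ hc] at h1
      linarith
    have hz : p ∈ bounceZone j := ⟨hp, hc, hpos, hj⟩
    exact (contDiffOn_mild_bounceZone hf₀ hBC hcomp j p hz).mono_of_mem_nhdsWithin
      (bounceZone_mem_nhdsWithin hz)

/-! ### Necessity of the compatibility condition -/

/-- On `A'` one branch represents the function on a full relative neighbourhood, so the derivatives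
agree there. Both are continuous up to `p`, and `A'` accumulates at `p`. -/
lemma fderivWithin_mild_eq_pullback (hf₀ : ContDiffOn ℝ 1 f₀ phase)
    (hBC : ∀ x ∈ circ, ∀ v : Plane, f₀ (x, v) = f₀ (x, specRefl x v))
    {A A' : Set (ℝ × Plane × Plane)} {p : ℝ × Plane × Plane}
    (hA : A ⊆ timePhase) (hc : ∀ q ∈ A, q.2 ∈ crossing) (hm : MapsTo (backward k) A phase)
    (hp : p ∈ A) (hA' : A' ⊆ A) (hnhds : ∀ q ∈ A', A ∈ 𝓝[timePhase] q) (hne : (𝓝[A'] p).NeBot)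
    (hC : ContDiffWithinAt ℝ 1 (mild f₀) timePhase p) :
    fderivWithin ℝ (mild f₀) timePhase p = pullback f₀ k p := by
  have h1 : Tendsto (fderivWithin ℝ (mild f₀) timePhase) (𝓝[A'] p)
      (𝓝 (fderivWithin ℝ (mild f₀) timePhase p)) :=
    ((hC.fderivWithin_right (m := 0) uniqueDiffOn_timePhase (by simp)
      (hA hp)).continuousWithinAt).mono (hA'.trans hA)
  have h2 : Tendsto (pullback f₀ k) (𝓝[A'] p) (𝓝 (pullback f₀ k p)) :=
    (continuousOn_pullback hf₀ hc hm p hp).mono hA'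
  refine tendsto_nhds_unique h1 (h2.congr' ?_)
  filter_upwards [self_mem_nhdsWithin] with q hq
  exact ((hasFDerivWithinAt_mild hf₀ hBC hA hc hm (hA' hq)).mono_of_mem_nhdsWithin
    (hnhds q hq)).fderivWithin (uniqueDiffOn_timePhase q (hA (hA' hq))) |>.symm

lemma neBot_of_curve {p : ℝ × Plane × Plane} (hp : p ∈ bounceZone k)
    {P : Set (ℝ × Plane × Plane)} {c : ℝ → ℝ × Plane × Plane} (hc : ContinuousAt c 0)
    (h0 : c 0 = p) (hmem : ∀ᶠ r in 𝓝[>] 0, c r ∈ timePhase ∧ c r ∈ P) :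
    (𝓝[bounceZone k ∩ P] p).NeBot := by
  have h1 : Tendsto c (𝓝[>] 0) (𝓝[timePhase] p) := by
    refine tendsto_nhdsWithin_iff.2 ⟨?_, hmem.mono fun r hr => hr.1⟩
    rw [← h0]
    exact hc.tendsto.mono_left nhdsWithin_le_nhds
  have h2 : Tendsto c (𝓝[>] 0) (𝓝[bounceZone k ∩ P] p) := by
    refine tendsto_nhdsWithin_iff.2 ⟨h1.mono_right nhdsWithin_le_nhds, ?_⟩
    filter_upwards [h1 (bounceZone_mem_nhdsWithin hp), hmem] with r h3 h4 using ⟨h3, h4.2⟩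
  exact h2.neBot

lemma neBot_after_bounce {p : ℝ × Plane × Plane} (hp : p ∈ bounceZone k)
    (h0 : exitTime (backward k p) = 0) :
    (𝓝[bounceZone k ∩ {q | exitTime (backward k q) < 0}] p).NeBot := by
  refine neBot_of_curve hp (c := fun r => (p.1 + r, p.2)) (by fun_prop) (by simp) ?_
  filter_upwards [self_mem_nhdsWithin] with r hr
  have hr' : 0 < r := hr
  have ht : 0 ≤ p.1 := hp.1.1
  refine ⟨⟨add_nonneg ht hr'.le, hp.1.2⟩, ?_⟩
  show exitTime (backward k (p.1 + r, p.2)) < 0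
  rw [exitTime_backward hp.2.1] at h0
  rw [exitTime_backward (p := (p.1 + r, p.2)) hp.2.1]
  linarith

lemma neBot_before_bounce {p : ℝ × Plane × Plane} (hp : p ∈ bounceZone k)
    (h0 : exitTime (backward k p) = 0) :
    (𝓝[bounceZone k ∩ {q | 0 < exitTime (backward k q)}] p).NeBot := by
  have ht : 0 ≤ p.1 := hp.1.1
  rcases ht.lt_or_eq with ht | ht
  · refine neBot_of_curve hp (c := fun r => (p.1 - r, p.2)) (by fun_prop) (by simp) ?_
    filter_upwards [self_mem_nhdsWithin, nhdsWithin_le_nhds (Iio_mem_nhds ht)] with r hr hr2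
    have hr' : 0 < r := hr
    have hr2' : r < p.1 := hr2
    refine ⟨⟨sub_nonneg.2 hr2'.le, hp.1.2⟩, ?_⟩
    show 0 < exitTime (backward k (p.1 - r, p.2))
    rw [exitTime_backward hp.2.1] at h0
    rw [exitTime_backward (p := (p.1 - r, p.2)) hp.2.1]
    linarith
  -- At `t = 0` time cannot be decreased. Moving `x` radially inward makes its exit time positive,
  -- and with it the clock of line `k`.
  · set c : ℝ → ℝ × Plane × Plane := fun r => (p.1, (1 - r) • p.2.1, p.2.2) with hcdef
    have hc0 : c 0 = p := by simp [hcdef]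
    have hcont : Continuous c := by fun_prop
    refine neBot_of_curve hp hcont.continuousAt hc0 ?_
    have hev : ∀ᶠ r in 𝓝 (0 : ℝ), (c r).2 ∈ crossing := by
      have h1 : ∀ᶠ q in 𝓝 (c 0), q.2 ∈ crossing := by
        rw [hc0]
        exact eventually_crossing hp.2.1
      exact hcont.continuousAt.eventually h1
    filter_upwards [self_mem_nhdsWithin, nhdsWithin_le_nhds (Iio_mem_nhds one_pos),
      nhdsWithin_le_nhds hev] with r hr hr1 hrc
    have hr' : 0 < r := hr
    have hr1' : r < 1 := hr1
    have hx : ‖p.2.1‖ ≤ 1 := mem_phase_iff.1 hp.1.2.1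
    have hlt : ‖(c r).2.1‖ < 1 := by
      show ‖(1 - r) • p.2.1‖ < 1
      rw [norm_smul, Real.norm_of_nonneg (by linarith)]
      nlinarith [norm_nonneg p.2.1]
    refine ⟨⟨ht.le, nonGrazing_of_mem_crossing hrc (mem_phase_iff.2 hlt.le)⟩, ?_⟩
    show 0 < exitTime (backward k (c r))
    rw [exitTime_backward hrc]
    have h1 := ((norm_lt_one_iff hrc).1 hlt).1
    have h2 : (c r).1 = 0 := ht.symm
    have h3 := chordTime_pos hrc
    rw [h2]
    positivity

theorem compatAt_of_contDiffWithinAt_mild (hf₀ : ContDiffOn ℝ 1 f₀ phase)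
    (hBC : ∀ x ∈ circ, ∀ v : Plane, f₀ (x, v) = f₀ (x, specRefl x v))
    {p : ℝ × Plane × Plane} (hp : p ∈ timePhase) (hc : p.2 ∈ crossing)
    (h0 : exitTime (backward k p) = 0) (hC : ContDiffWithinAt ℝ 1 (mild f₀) timePhase p) :
    CompatAt f₀ (backward k p).1 (backward k p).2 := by
  have hl := chordTime_pos hc
  have hz : p ∈ bounceZone k :=
    ⟨hp, hc, by rw [exitTime_backward_succ hc, h0, zero_add]; exact hl, by rw [h0]; exact hl⟩
  have h1 : fderivWithin ℝ (mild f₀) timePhase p = pullback f₀ k p := by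
    refine fderivWithin_mild_eq_pullback hf₀ hBC
      (A' := bounceZone k ∩ {q | 0 < exitTime (backward k q)})
      (fun r hr => hr.1.1) (fun r hr => hr.1.2.1) (mapsTo_backward k) ⟨hz, h0.ge⟩
      (fun r hr => ⟨hr.1, (show 0 < exitTime (backward k r) from hr.2).le⟩) (fun q hq => ?_)
      (neBot_before_bounce hz h0) hC
    filter_upwards [bounceZone_mem_nhdsWithin hq.1, nhdsWithin_le_nhds
      ((continuousAt_exitTime_backward hq.1.2.1 k).eventually_const_lt hq.2)] with r h3 h4
    exact ⟨h3, le_of_lt h4⟩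
  have h2 : fderivWithin ℝ (mild f₀) timePhase p = pullback f₀ (k + 1) p := by
    refine fderivWithin_mild_eq_pullback hf₀ hBC
      (A' := bounceZone k ∩ {q | exitTime (backward k q) < 0})
      (fun r hr => hr.1.1) (fun r hr => hr.1.2.1) (mapsTo_backward_succ k) ⟨hz, h0.le⟩
      (fun r hr => ⟨hr.1, (show exitTime (backward k r) < 0 from hr.2).le⟩) (fun q hq => ?_)
      (neBot_after_bounce hz h0) hC
    filter_upwards [bounceZone_mem_nhdsWithin hq.1, nhdsWithin_le_nhds
      ((continuousAt_exitTime_backward hq.1.2.1 k).eventually_lt_const hq.2)] with r h3 h4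
    exact ⟨h3, le_of_lt h4⟩
  exact (pullback_succ_eq hf₀ hBC hc (mem_gammaMinus_of_exitTime_eq_zero
    (backward_mem_crossing hc k) h0)).1 (h2.symm.trans h1)

/-! ### The mild solution solves the transport problem -/

lemma timePhase_mem_nhds (ht : 0 < t) (hx : ‖x‖ < 1) (v : Plane) :
    timePhase ∈ 𝓝 (t, x, v) := by
  refine prod_mem_nhds (Ici_mem_nhds ht) ?_
  have hopen : IsOpen {z : Plane × Plane | ‖z.1‖ < 1} :=
    isOpen_lt (by fun_prop) continuous_const
  filter_upwards [hopen.mem_nhds (show ‖(x, v).1‖ < 1 from hx)] with z hz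
  have hz' : ‖z.1‖ < 1 := hz
  exact ⟨mem_phase_iff.2 hz'.le, fun h => hz'.ne h.1⟩

lemma hasFDerivAt_of_contDiffOn {g : ℝ × Plane × Plane → ℝ} (hg : ContDiffOn ℝ 1 g timePhase)
    (ht : 0 < t) (hx : ‖x‖ < 1) (v : Plane) :
    HasFDerivAt g (fderiv ℝ g (t, x, v)) (t, x, v) :=
  ((hg.contDiffAt (timePhase_mem_nhds ht hx v)).differentiableAt one_ne_zero).hasFDerivAt

/-- The transport operator is the derivative in the direction `(1, v, 0)`. -/
lemma deriv_add_fderiv_eq {g : ℝ × Plane × Plane → ℝ} {L : ℝ × Plane × Plane →L[ℝ] ℝ}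
    (h : HasFDerivAt g L (t, x, v)) :
    deriv (fun s : ℝ => g (s, x, v)) t + fderiv ℝ (fun y : Plane => g (t, y, v)) x v =
      L (1, v, 0) := by
  have h1 : HasDerivAt (fun s : ℝ => g (s, x, v)) (L (1, 0, 0)) t :=
    h.comp_hasDerivAt t ((hasDerivAt_id t).prodMk (hasDerivAt_const t (x, v)))
  have h2 := h.comp x (f := fun y : Plane => (t, y, v))
    ((hasFDerivAt_const t x).prodMk ((hasFDerivAt_id x).prodMk (hasFDerivAt_const v x)))
  have h3 : fderiv ℝ (fun y : Plane => g (t, y, v)) x v = L (0, v, 0) := by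
    have := h2.fderiv
    rw [show (fun y : Plane => g (t, y, v)) = g ∘ fun y : Plane => (t, y, v) from rfl, this]
    rfl
  rw [h1.deriv, h3, ← map_add]
  simp

/-- Moving along free transport leaves `x - t v` unchanged, hence also every unfolded line. -/
lemma mild_shift (hBC : ∀ x ∈ circ, ∀ v : Plane, f₀ (x, v) = f₀ (x, specRefl x v)) {r : ℝ}
    (hp : (t, x, v) ∈ timePhase) (hq : (t + r, x + r • v, v) ∈ timePhase) :
    mild f₀ (t + r, x + r • v, v) = mild f₀ (t, x, v) := by
  have hbase : x + r • v - (t + r) • v = x - t • v := by module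
  by_cases hv : v = 0
  · subst hv
    have hx : ‖x‖ ≤ 1 := (mem_phase_iff (z := (x, 0))).1 hp.2.1
    rw [mild_free hBC hp (by simpa using hx), mild_free hBC hq (by simpa using hx)]
    simp
  · have hc : (x, v) ∈ crossing := mem_crossing_of_nonGrazing hp.2 hv
    have hc' : (x + r • v, v) ∈ crossing := mem_crossing_of_nonGrazing hq.2 hv
    obtain ⟨k, hk, -⟩ := exists_backward_mem_phase hp hc
    have hb : backward k (t + r, x + r • v, v) = backward k (t, x, v) := by
      simp only [backward, hbase]
    rw [mild_eq hBC hp hc hk, mild_eq hBC hq hc' (by rw [hb]; exact hk), hb]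

lemma transport_mild (hBC : ∀ x ∈ circ, ∀ v : Plane, f₀ (x, v) = f₀ (x, specRefl x v))
    (hC : ContDiffOn ℝ 1 (mild f₀) timePhase) (ht : 0 < t) (hx : ‖x‖ < 1) (v : Plane) :
    deriv (fun s : ℝ => mild f₀ (s, x, v)) t +
      fderiv ℝ (fun y : Plane => mild f₀ (t, y, v)) x v = 0 := by
  have hd := hasFDerivAt_of_contDiffOn hC ht hx v
  rw [deriv_add_fderiv_eq hd]
  have h1 := hd.hasLineDerivAt (1, v, 0)
  have hcurve : Continuous fun r : ℝ => (t + r, x + r • v, v) := by fun_prop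
  have hmem : ∀ᶠ r in 𝓝 (0 : ℝ), (t + r, x + r • v, v) ∈ timePhase := by
    have : timePhase ∈ 𝓝 (t + (0 : ℝ), x + (0 : ℝ) • v, v) := by
      simpa using timePhase_mem_nhds ht hx v
    exact hcurve.continuousAt.eventually this
  have hp : (t, x, v) ∈ timePhase := mem_of_mem_nhds (timePhase_mem_nhds ht hx v)
  have h2 : HasDerivAt (fun r : ℝ => mild f₀ ((t, x, v) + r • (1, v, 0))) 0 0 := by
    refine (hasDerivAt_const (0 : ℝ) (mild f₀ (t, x, v))).congr_of_eventuallyEq ?_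
    filter_upwards [hmem] with r hr
    have : (t, x, v) + r • ((1 : ℝ), v, (0 : Plane)) = (t + r, x + r • v, v) := by simp
    rw [this, mild_shift hBC hp hr]
  exact h1.unique h2

lemma specular_mild_of_gammaMinus
    (hBC : ∀ x ∈ circ, ∀ v : Plane, f₀ (x, v) = f₀ (x, specRefl x v))
    (ht : 0 ≤ t) (h : (x, v) ∈ gammaMinus) :
    mild f₀ (t, x, v) = mild f₀ (t, x, specRefl x v) := by
  have hx : ‖x‖ = 1 := h.1
  have hc := gammaMinus_subset_crossing h
  have h0 := exitTime_of_gammaMinus h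
  have he : entry (x, v) = x := entry_of_exitTime_eq_zero h0
  have hc' : (x, specRefl x v) ∈ crossing := by
    have := reflect_mem_crossing hc
    rwa [he] at this
  have hph : ∀ w : Plane, (x, w) ∈ phase := fun w => mem_phase_iff.2 hx.le
  have hp : (t, x, v) ∈ timePhase := ⟨ht, nonGrazing_of_mem_crossing hc (hph v)⟩
  have hp' : (t, x, specRefl x v) ∈ timePhase :=
    ⟨ht, nonGrazing_of_mem_crossing hc' (hph _)⟩
  obtain ⟨k, hk, -⟩ := exists_backward_mem_phase hp' hc'
  -- From an incoming point the first unfolding is the reflection at `x` itself, so one extra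
  -- unfolding compensates for the reflected velocity.
  have hb : backward (k + 1) (t, x, v) = backward k (t, x, specRefl x v) := by
    rw [backward, Function.iterate_succ_apply, backward]
    congr 1
    rw [unfold, entry_shift hc, exitTime_shift hc, he, h0]
    ext1
    · simp only; module
    · rfl
  rw [mild_eq hBC hp' hc' hk, mild_eq (k := k + 1) hBC hp hc (by rw [hb]; exact hk), hb]

lemma specular_mild (hBC : ∀ x ∈ circ, ∀ v : Plane, f₀ (x, v) = f₀ (x, specRefl x v))
    (ht : 0 ≤ t) (hx : ‖x‖ = 1) (v : Plane) :
    mild f₀ (t, x, v) = mild f₀ (t, x, specRefl x v) := by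
  rcases lt_trichotomy (inner ℝ v x) 0 with h | h | h
  · exact specular_mild_of_gammaMinus hBC ht ⟨hx, h⟩
  · rw [specRefl_of_inner_eq_zero h]
  · have h' : inner ℝ (specRefl x v) x < 0 := by
      rw [inner_specRefl_self hx]; linarith
    have := specular_mild_of_gammaMinus hBC ht (x := x) (v := specRefl x v) ⟨hx, h'⟩
    rw [specRefl_specRefl hx] at this
    exact this.symm

lemma initial_mild (hBC : ∀ x ∈ circ, ∀ v : Plane, f₀ (x, v) = f₀ (x, specRefl x v))
    (hz : z ∈ nonGrazing) : mild f₀ (0, z) = f₀ z := by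
  have h := mild_free (p := (0, z)) hBC ⟨le_refl (0 : ℝ), hz⟩
    (by simpa using mem_phase_iff.1 hz.1)
  simpa using h

theorem isC1Solution_mild (hf₀ : ContDiffOn ℝ 1 f₀ phase)
    (hBC : ∀ x ∈ circ, ∀ v : Plane, f₀ (x, v) = f₀ (x, specRefl x v))
    (hcomp : ∀ p ∈ gammaMinus, CompatAt f₀ p.1 p.2) : IsC1Solution f₀ (mild f₀) where
  contDiffOn := contDiffOn_mild hf₀ hBC hcomp
  transport _ ht _ hx v := transport_mild hBC (contDiffOn_mild hf₀ hBC hcomp) ht hx v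
  specular _ ht _ hx v := specular_mild hBC ht hx v
  initial _ hp := initial_mild hBC hp

/-! ### Uniqueness -/

/-- Solutions are constant along the straight pieces of the characteristics. -/
lemma IsC1Solution.eq_along_segment {g : ℝ × Plane × Plane → ℝ} (hg : IsC1Solution f₀ g) {r : ℝ}
    (hr : 0 ≤ r) (hrt : r ≤ t) (hmem : ∀ s ∈ Icc 0 r, (x - s • v, v) ∈ nonGrazing)
    (hin : ∀ s ∈ Ioo 0 r, ‖x - s • v‖ < 1) : g (t, x, v) = g (t - r, x - r • v, v) := by
  rcases hr.lt_or_eq with hr | rfl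
  swap
  · simp
  have hcont : ContinuousOn (fun s : ℝ => g (t - s, x - s • v, v)) (Icc 0 r) := by
    refine hg.contDiffOn.continuousOn.comp (f := fun s : ℝ => (t - s, x - s • v, v))
      (by fun_prop) fun s hs => ⟨?_, hmem s hs⟩
    exact sub_nonneg.2 (hs.2.trans hrt)
  have hder : ∀ s ∈ Ioo 0 r, HasDerivAt (fun s : ℝ => g (t - s, x - s • v, v)) 0 s := by
    intro s hs
    have hts : 0 < t - s := sub_pos.2 (hs.2.trans_le hrt)
    have hd := hasFDerivAt_of_contDiffOn hg.contDiffOn hts (hin s hs) v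
    have hcurve : HasDerivAt (fun s : ℝ => (t - s, x - s • v, v)) (-((1 : ℝ), v, (0 : Plane))) s := by
      have h1 := (hasDerivAt_id s).const_sub t
      have h2 := ((hasDerivAt_id s).smul_const v).const_sub x
      refine (h1.prodMk (h2.prodMk (hasDerivAt_const s v))).congr_deriv ?_
      simp
    refine (hd.comp_hasDerivAt s hcurve).congr_deriv ?_
    rw [map_neg, ← deriv_add_fderiv_eq hd, hg.transport _ hts _ (hin s hs), neg_zero]
  -- The mean value theorem needs only continuity at the endpoints, which may lie on the circle or
  -- at time `0`.
  obtain ⟨c, -, hc⟩ := exists_hasDerivAt_eq_slope _ (fun _ => 0) hr hcont hder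
  rw [eq_comm, div_eq_zero_iff] at hc
  rcases hc with hc | hc
  · simp only [zero_smul, sub_zero] at hc
    linarith
  · linarith

lemma IsC1Solution.eq_of_le_exitTime {g : ℝ × Plane × Plane → ℝ} (hg : IsC1Solution f₀ g) {r : ℝ}
    (hz : (x, v) ∈ crossing) (hp : (x, v) ∈ phase) (hr : 0 ≤ r) (hrt : r ≤ t)
    (hre : r ≤ exitTime (x, v)) : g (t, x, v) = g (t - r, x - r • v, v) := by
  obtain ⟨-, h1⟩ := (norm_le_one_iff hz).1 (mem_phase_iff.1 hp)
  refine hg.eq_along_segment hr hrt (fun s hs => ?_) fun s hs => ?_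
  · refine nonGrazing_of_mem_crossing (crossing_shift.2 hz) (mem_phase_iff.2 ?_)
    rw [norm_le_one_iff (crossing_shift.2 hz), exitTime_shift hz, chordTime_shift]
    constructor <;> linarith [hs.1, hs.2]
  · refine (norm_lt_one_iff (z := (x - s • v, v)) (crossing_shift.2 hz)).2 ?_
    rw [exitTime_shift hz, chordTime_shift]
    constructor <;> linarith [hs.1, hs.2]

lemma IsC1Solution.eq_of_crossing {g₁ g₂ : ℝ × Plane × Plane → ℝ} (h₁ : IsC1Solution f₀ g₁)
    (h₂ : IsC1Solution f₀ g₂) (n : ℕ) : ∀ (t : ℝ) (x v : Plane), 0 ≤ t → (x, v) ∈ crossing →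
      (x, v) ∈ phase → t ≤ exitTime (x, v) + n * chordTime (x, v) →
      g₁ (t, x, v) = g₂ (t, x, v) := by
  have base : ∀ (t : ℝ) (x v : Plane), 0 ≤ t → (x, v) ∈ crossing → (x, v) ∈ phase →
      t ≤ exitTime (x, v) → g₁ (t, x, v) = g₂ (t, x, v) := by
    intro t x v ht hz hp hle
    obtain ⟨-, h1⟩ := (norm_le_one_iff hz).1 (mem_phase_iff.1 hp)
    have hng : (x - t • v, v) ∈ nonGrazing := by
      refine nonGrazing_of_mem_crossing (crossing_shift.2 hz) (mem_phase_iff.2 ?_)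
      rw [norm_le_one_iff (crossing_shift.2 hz), exitTime_shift hz, chordTime_shift]
      constructor <;> linarith
    rw [h₁.eq_of_le_exitTime hz hp ht le_rfl hle, h₂.eq_of_le_exitTime hz hp ht le_rfl hle,
      sub_self, h₁.initial _ hng, h₂.initial _ hng]
  induction n with
  | zero =>
    intro t x v ht hz hp hle
    exact base t x v ht hz hp (by simpa using hle)
  | succ n ih =>
    intro t x v ht hz hp hle
    rcases le_or_gt t (exitTime (x, v)) with h | h
    · exact base t x v ht hz hp h
    · obtain ⟨h0, -⟩ := (norm_le_one_iff hz).1 (mem_phase_iff.1 hp)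
      have ht' : 0 ≤ t - exitTime (x, v) := by linarith
      have hn : ‖entry (x, v)‖ = 1 := norm_entry hz
      rw [h₁.eq_of_le_exitTime hz hp h0 h.le le_rfl, h₂.eq_of_le_exitTime hz hp h0 h.le le_rfl]
      change g₁ (t - exitTime (x, v), entry (x, v), v) = g₂ (t - exitTime (x, v), entry (x, v), v)
      rw [h₁.specular _ ht' _ hn, h₂.specular _ ht' _ hn]
      -- The reflected state at the entry point has a whole chord behind it, so its exit time
      -- absorbs one of the `n + 1` chord times.
      refine ih _ _ _ ht' (reflect_mem_crossing hz) (mem_phase_iff.2 hn.le) ?_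
      rw [exitTime_reflect (z := (x, v)) hz, chordTime_reflect (z := (x, v)) hz]
      push_cast at hle
      linarith

theorem IsC1Solution.eqOn {g₁ g₂ : ℝ × Plane × Plane → ℝ} (h₁ : IsC1Solution f₀ g₁)
    (h₂ : IsC1Solution f₀ g₂) : EqOn g₁ g₂ timePhase := by
  rintro ⟨t, x, v⟩ hp
  have ht : 0 ≤ t := hp.1
  by_cases hv : v = 0
  · subst hv
    have hx : ‖x‖ < 1 := norm_lt_one_of_nonGrazing (z := (x, 0)) hp.2 rfl
    have key : ∀ g, IsC1Solution f₀ g → g (t, x, 0) = f₀ (x, 0) := by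
      intro g hg
      rw [hg.eq_along_segment (r := t) ht le_rfl (fun s _ => by simpa using hp.2)
        (fun s _ => by simpa using hx), sub_self, smul_zero, sub_zero, hg.initial _ hp.2]
    rw [key g₁ h₁, key g₂ h₂]
  · have hc : (x, v) ∈ crossing := mem_crossing_of_nonGrazing hp.2 hv
    obtain ⟨n, hn⟩ := exists_nat_gt ((t - exitTime (x, v)) / chordTime (x, v))
    rw [div_lt_iff₀ (chordTime_pos hc)] at hn
    exact h₁.eq_of_crossing h₂ n t x v ht hc hp.2.1 (by linarith)

lemma tk_succ_at_rest (t : ℝ) (hx : ‖x‖ < 1) (k : ℕ) : tk t x 0 (k + 1) ≠ 0 := by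
  refine ne_of_lt (lt_of_le_of_lt (tk_antitone t x 0 (Nat.le_add_left 1 k)) ?_)
  exact tk_one_at_rest t hx

end DiskTransport
end

open DiskTransport
theorem theorem1 (f₀ : Plane × Plane → ℝ)
    (hf₀ : ContDiffOn ℝ 1 f₀ phase)
    (hBC : ∀ x ∈ circ, ∀ v : Plane, f₀ (x, v) = f₀ (x, specRefl x v)) :
    ((∀ p ∈ gammaMinus, CompatAt f₀ p.1 p.2) →
      IsC1Solution f₀ (mild f₀) ∧
      (∀ g : ℝ × Plane × Plane → ℝ, IsC1Solution f₀ g → EqOn g (mild f₀) timePhase) ∧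
      (∀ p ∈ gammaPlus, CompatAt f₀ p.1 p.2)) ∧
    (∀ (t : ℝ) (x v : Plane) (k : ℕ), (t, x, v) ∈ timePhase → tk t x v (k + 1) = 0 →
      ¬ CompatAt f₀ (xk t x v (k + 1)) (vk t x v k) →
      ¬ ContDiffWithinAt ℝ 1 (mild f₀) timePhase (t, x, v)) := by
  refine ⟨fun hcomp => ?_, fun t x v k hp htk hncomp hC => hncomp ?_⟩
  · have hsol := isC1Solution_mild hf₀ hBC hcomp
    refine ⟨hsol, fun g hg => hg.eqOn hsol, fun p hp => ?_⟩
    have hx : ‖p.1‖ = 1 := hp.1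
    have hmem : (p.1, specRefl p.1 p.2) ∈ gammaMinus :=
      ⟨hx, by
        show inner ℝ (specRefl p.1 p.2) p.1 < 0
        rw [inner_specRefl_self hx]
        exact neg_neg_of_pos hp.2⟩
    have h := (hcomp _ hmem).specRefl hx
    rwa [specRefl_specRefl hx] at h
  · have hv : v ≠ 0 := by
      rintro rfl
      exact tk_succ_at_rest t (norm_lt_one_of_nonGrazing (z := (x, 0)) hp.2 rfl) k htk
    have hc : (x, v) ∈ crossing := mem_crossing_of_nonGrazing hp.2 hv
    have hph : (x, v) ∈ phase := hp.2.1
    have h0 : exitTime (backward k (t, x, v)) = 0 := by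
      rw [tk_succ_of_crossing hc hph, EReal.coe_eq_zero] at htk
      linarith
    -- Because the clock of line `k` vanishes, its base point is its entry point; so `(xᵏ⁺¹, vᵏ)` is
    -- `backward k (t, x, v)` itself.
    rw [xk_succ_of_crossing hc hph, vk_eq_of_crossing hc hph, entry_of_exitTime_eq_zero h0]
    exact compatAt_of_contDiffWithinAt_mild hf₀ hBC hp hc h0 hC
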